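/- Let $M$ be a smooth surface, let $D\subset M$ be an open set (a domain), and let $S:TD\to TD$ be a smooth field of endomorphisms of the tangent planes that is diagonalizable with smooth real eigenvalue functions $A,B$ satisfying $A\neq B$ everywhere on $D$. For a function $f$ on $D$ write $\mathrm{d}f=\mathrm{d}'f+\mathrm{d}''f$, where $\mathrm{d}'f$ vanishes on the $B$-eigenlines of $S$ and $\mathrm{d}''f$ vanishes on the $A$-eigenlines. Assume that $S$ is nondegenerate, i.e. $A-B$, $\mathrm{d}''A$ and $\mathrm{d}'B$ vanish nowhere on $D$, and invertible, i.e. $AB$ vanishes nowhere on $D$. Let $$\theta_1=\frac{A\,\mathrm{d}'B}{B(B-A)},\qquad \theta_2=\frac{B\,\mathrm{d}''A}{A(A-B)},$$ which form a coframing of $D$, and define functions $K_1,K_2,K_{11},K_{12},K_{21},K_{22}$ on $D$ by $$\mathrm{d}\theta_1=K_1\,\theta_1\wedge\theta_2,\quad \mathrm{d}\theta_2=K_2\,\theta_2\wedge\theta_1,\quad \mathrm{d}K_i=K_{i1}\theta_1+K_{i2}\theta_2 .$$ Consider the total differential system for three unknown functions $a,b,p$ on $D$: $$\begin{aligned} \mathrm{d}a&=(2a+p+1)\,\theta_1+2a(1-K_1)\,\theta_2,\\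 \mathrm{d}b&=2b(1-K_2)\,\theta_1+(2b-p+1)\,\theta_2,\\ \mathrm{d}p&=\bigl((2-K_2)(p-1)+2(K_1-K_2-K_1K_2+K_{22})\,b\bigr)\theta_1+\bigl((2-K_1)(p+1)+2(K_1-K_2+K_1K_2-K_{11})\,a\bigr)\theta_2 . \end{aligned}$$ It is called Frobenius if the Pfaffian system on $D\times\mathbb{R}^3$ generated by the three $1$-forms (left side minus right side) satisfies the Frobenius condition, i.e. the exterior derivatives of these forms vanish modulo the forms themselves at every point of $D\times\mathbb{R}^3$. Consider also the following three systems of structure equations: (I) $\mathrm{d}\theta_1=\theta_1\wedge\theta_2$, $\ \mathrm{d}\theta_2=K_2\,\theta_2\wedge\theta_1$, $\ \mathrm{d}K_2=K_{21}\theta_1+2(K_2-1)\theta_2$; (I$^*$) $\mathrm{d}\theta_1=K_1\,\theta_1\wedge\theta_2$, $\ \mathrm{d}\theta_2=\theta_2\wedge\theta_1$, $\ \mathrm{d}K_1=2(K_1-1)\theta_1+K_{12}\theta_2$; (II) $\mathrm{d}\theta_1=-2\,\theta_1\wedge\theta_2$, $\ \mathrm{d}\theta_2=-2\,\theta_2\wedge\theta_1$.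 Then: if $D$ is connected and the system for $(a,b,p)$ is Frobenius, then either $D=D_1\cup D_2$ for two open sets $D_1,D_2$ (possibly empty) such that (I) holds on $D_1$ and (I$^*$) holds on $D_2$, or else (II) holds on all of $D$. Conversely (whether or not $D$ is connected), if one of the three systems (I), (I$^*$), (II) holds on all of $D$, then the system for $(a,b,p)$ is Frobenius. -/

import Mathlib

open Set
open scoped Manifold ContDiff

noncomputable section

namespace ShapeOperator

/-! ### One-forms and the exterior derivative on a manifold -/

section Forms

variable {E : Type*} [NormedAddCommGroup E] [NormedSpace ℝ E]
  {H : Type*} [TopologicalSpace H] (I : ModelWithCorners ℝ E H)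
  {N : Type*} [TopologicalSpace N] [ChartedSpace H N]

variable (N) in
/-- A (not necessarily continuous) field of one-forms on the manifold `N`. -/
abbrev OneForm : Type _ := ∀ x : N, TangentSpace I x →L[ℝ] ℝ

variable {I}

/-- The wedge product of two covectors: `(α ∧ β)(v, w) = α(v) β(w) - α(w) β(v)`. -/
def wedge {x : N} (α β : TangentSpace I x →L[ℝ] ℝ) (v w : TangentSpace I x) : ℝ :=
  α v * β w - α w * β v

/-- The one-form `φ` written in the preferred chart at `x`, i.e. its pullback by the inverse of
this chart, as an alternating-form-valued function on the model space. -/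
def chartForm (φ : OneForm I N) (x : N) (u : E) : E [⋀^Fin 1]→L[ℝ] ℝ :=
  ContinuousAlternatingMap.ofSubsingleton ℝ E ℝ (0 : Fin 1)
    ((φ ((extChartAt I x).symm u)).comp (mfderiv 𝓘(ℝ, E) I (extChartAt I x).symm u))

/-- The exterior derivative `dφ` of a one-form on a manifold without boundary, at the point `x`,
as a bilinear function on the tangent space: the exterior derivative is taken in the chart at `x`
and pulled back. -/
def extD (φ : OneForm I N) (x : N) (v w : TangentSpace I x) : ℝ :=
  extDeriv (chartForm φ x) (extChartAt I x x)
    ![mfderiv I 𝓘(ℝ, E) (extChartAt I x) x v, mfderiv I 𝓘(ℝ, E) (extChartAt I x) x w]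

/-- The Frobenius condition at `q` for the Pfaffian system `ψ i = 0`: the two-forms `dψ i` vanish
modulo the `ψ j`, that is, they vanish on the common kernel of the `ψ j`. -/
def IsFrobeniusAt {ι : Type*} (ψ : ι → OneForm I N) (q : N) : Prop :=
  ∀ v w : TangentSpace I q, (∀ j, ψ j q v = 0) → (∀ j, ψ j q w = 0) →
    ∀ i, extD (ψ i) q v w = 0

end Forms

/-! ### Operators on the tangent bundle of a surface -/

/-- The model of a surface. -/
abbrev Plane : Type := EuclideanSpace ℝ (Fin 2)

variable {M : Type*} [TopologicalSpace M] [ChartedSpace Plane M]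

variable (M) in
/-- A field of endomorphisms `S : TM → TM` of the tangent spaces of the surface `M`. -/
abbrev EndoField : Type _ := ∀ x : M, TangentSpace (𝓡 2) x →L[ℝ] TangentSpace (𝓡 2) x

/-- If `S x` has the distinct eigenvalues `l` and `m`, this is the projection of the tangent space
onto the `l`-eigenline along the `m`-eigenline. -/
def eigenProj (S : EndoField M) (l m : M → ℝ) (x : M) :
    TangentSpace (𝓡 2) x →L[ℝ] TangentSpace (𝓡 2) x :=
  (l x - m x)⁻¹ • (S x - m x • ContinuousLinearMap.id ℝ (TangentSpace (𝓡 2) x))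

/-- `d' f`, the component of `df` that vanishes on the `B`-eigenlines of `S`. -/
def dPrime (S : EndoField M) (A B : M → ℝ) (f : M → ℝ) : OneForm (𝓡 2) M :=
  fun x => (mvfderiv (𝓡 2) f x).comp (eigenProj S A B x)

/-- `d'' f`, the component of `df` that vanishes on the `A`-eigenlines of `S`. -/
def dPrime₂ (S : EndoField M) (A B : M → ℝ) (f : M → ℝ) : OneForm (𝓡 2) M :=
  fun x => (mvfderiv (𝓡 2) f x).comp (eigenProj S B A x)

/-- On the open set `D`, the operator `S` is smooth and diagonalizable with smooth eigenvalue
functions `A` and `B`, it is nondegenerate (`A ≠ B`, and `d'' A` and `d' B` vanish nowhere),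
and it is invertible (`A` and `B` vanish nowhere). -/
structure IsInvertibleNondegenerate [IsManifold (𝓡 2) ∞ M]
    (S : EndoField M) (A B : M → ℝ) (D : Set M) : Prop where
  smooth : ContMDiffOn (𝓡 2) ((𝓡 2).prod 𝓘(ℝ, Plane →L[ℝ] Plane)) ∞
    (fun x => (⟨x, S x⟩ : Bundle.TotalSpace (Plane →L[ℝ] Plane)
      (fun x : M => TangentSpace (𝓡 2) x →L[ℝ] TangentSpace (𝓡 2) x))) D
  smooth_A : ContMDiffOn (𝓡 2) 𝓘(ℝ, ℝ) ∞ A D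
  smooth_B : ContMDiffOn (𝓡 2) 𝓘(ℝ, ℝ) ∞ B D
  eigen_A : ∀ x ∈ D, Module.End.HasEigenvalue (S x).toLinearMap (A x)
  eigen_B : ∀ x ∈ D, Module.End.HasEigenvalue (S x).toLinearMap (B x)
  ne : ∀ x ∈ D, A x ≠ B x
  dA_ne : ∀ x ∈ D, dPrime₂ S A B A x ≠ 0
  dB_ne : ∀ x ∈ D, dPrime S A B B x ≠ 0
  A_ne : ∀ x ∈ D, A x ≠ 0
  B_ne : ∀ x ∈ D, B x ≠ 0

/-- `θ₁ = A d'B / (B (B - A))`. -/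
def theta₁ (S : EndoField M) (A B : M → ℝ) : OneForm (𝓡 2) M :=
  fun x => (A x / (B x * (B x - A x))) • dPrime S A B B x

/-- `θ₂ = B d''A / (A (A - B))`. -/
def theta₂ (S : EndoField M) (A B : M → ℝ) : OneForm (𝓡 2) M :=
  fun x => (B x / (A x * (A x - B x))) • dPrime₂ S A B A x

/-! ### Invariants of a coframing and the three systems of structure equations -/

/-- The coordinate basis of the tangent plane at `x` in the preferred chart at `x`. -/
def tangentBasis (x : M) (i : Fin 2) : TangentSpace (𝓡 2) x :=
  (EuclideanSpace.single i (1 : ℝ) : Plane)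

/-- For a two-form `Ω` on the tangent plane of the surface at `x`, the number `c` such that
`Ω = c θ₁ ∧ θ₂` at `x`, obtained by evaluating both sides on a basis. -/
def ratio (θ₁ θ₂ : OneForm (𝓡 2) M) (x : M)
    (Ω : TangentSpace (𝓡 2) x → TangentSpace (𝓡 2) x → ℝ) : ℝ :=
  Ω (tangentBasis x 0) (tangentBasis x 1) /
    wedge (θ₁ x) (θ₂ x) (tangentBasis x 0) (tangentBasis x 1)

/-- The function `K₁` with `dθ₁ = K₁ θ₁ ∧ θ₂`. -/
def curv₁ (θ₁ θ₂ : OneForm (𝓡 2) M) (x : M) : ℝ := ratio θ₁ θ₂ x (extD θ₁ x)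

/-- The function `K₂` with `dθ₂ = K₂ θ₂ ∧ θ₁`. -/
def curv₂ (θ₁ θ₂ : OneForm (𝓡 2) M) (x : M) : ℝ := -ratio θ₁ θ₂ x (extD θ₂ x)

/-- The function `f₁` in `df = f₁ θ₁ + f₂ θ₂`. -/
def coeff₁ (θ₁ θ₂ : OneForm (𝓡 2) M) (f : M → ℝ) (x : M) : ℝ :=
  ratio θ₁ θ₂ x (wedge (mvfderiv (𝓡 2) f x) (θ₂ x))

/-- The function `f₂` in `df = f₁ θ₁ + f₂ θ₂`. -/
def coeff₂ (θ₁ θ₂ : OneForm (𝓡 2) M) (f : M → ℝ) (x : M) : ℝ :=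
  ratio θ₁ θ₂ x (wedge (θ₁ x) (mvfderiv (𝓡 2) f x))

/-- The first system of Type I on `O`: for some functions `K₂` and `K₂₁`, one has
`dθ₁ = θ₁ ∧ θ₂`, `dθ₂ = K₂ θ₂ ∧ θ₁` and `dK₂ = K₂₁ θ₁ + 2 (K₂ - 1) θ₂` on `O`. -/
def TypeIOn (θ₁ θ₂ : OneForm (𝓡 2) M) (O : Set M) : Prop :=
  ∃ K₂ K₂₁ : M → ℝ, ∀ x ∈ O,
    (∀ v w, extD θ₁ x v w = wedge (θ₁ x) (θ₂ x) v w) ∧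
    (∀ v w, extD θ₂ x v w = K₂ x * wedge (θ₂ x) (θ₁ x) v w) ∧
    mvfderiv (𝓡 2) K₂ x = K₂₁ x • θ₁ x + (2 * (K₂ x - 1)) • θ₂ x

/-- The dual system of Type I on `O`: for some functions `K₁` and `K₁₂`, one has
`dθ₁ = K₁ θ₁ ∧ θ₂`, `dθ₂ = θ₂ ∧ θ₁` and `dK₁ = 2 (K₁ - 1) θ₁ + K₁₂ θ₂` on `O`. -/
def TypeIDualOn (θ₁ θ₂ : OneForm (𝓡 2) M) (O : Set M) : Prop :=
  ∃ K₁ K₁₂ : M → ℝ, ∀ x ∈ O,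
    (∀ v w, extD θ₁ x v w = K₁ x * wedge (θ₁ x) (θ₂ x) v w) ∧
    (∀ v w, extD θ₂ x v w = wedge (θ₂ x) (θ₁ x) v w) ∧
    mvfderiv (𝓡 2) K₁ x = (2 * (K₁ x - 1)) • θ₁ x + K₁₂ x • θ₂ x

/-- The system of Type II on `O`: `dθ₁ = -2 θ₁ ∧ θ₂` and `dθ₂ = -2 θ₂ ∧ θ₁` on `O`. -/
def TypeIIOn (θ₁ θ₂ : OneForm (𝓡 2) M) (O : Set M) : Prop :=
  ∀ x ∈ O,
    (∀ v w, extD θ₁ x v w = -2 * wedge (θ₁ x) (θ₂ x) v w) ∧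
    (∀ v w, extD θ₂ x v w = -2 * wedge (θ₂ x) (θ₁ x) v w)

/-! ### The total differential system for `(a, b, p)` -/

/-- The model of the five-dimensional manifold `M × ℝ³`, with fibre coordinates `(a, b, p)`. -/
abbrev abpModel : ModelWithCorners ℝ (Plane × (ℝ × ℝ × ℝ))
    (ModelProd Plane (ℝ × ℝ × ℝ)) :=
  (𝓡 2).prod 𝓘(ℝ, ℝ × ℝ × ℝ)

/-- The pullback to `M × ℝ³` of a one-form on `M`. -/
def lift (θ : OneForm (𝓡 2) M) : OneForm abpModel (M × (ℝ × ℝ × ℝ)) :=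
  fun q => (θ q.1).comp (mfderiv abpModel (𝓡 2) Prod.fst q)

/-- The Pfaffian form of the total differential system
`da = (2a + p + 1) θ₁ + 2a (1 - K₁) θ₂`,
`db = 2b (1 - K₂) θ₁ + (2b - p + 1) θ₂`,
`dp = ((2 - K₂)(p - 1) + 2 (K₁ - K₂ - K₁ K₂ + K₂₂) b) θ₁
    + ((2 - K₁)(p + 1) + 2 (K₁ - K₂ + K₁ K₂ - K₁₁) a) θ₂`:
the three one-forms on `M × ℝ³` given by left side minus right side. -/
def abpSystem (θ₁ θ₂ : OneForm (𝓡 2) M) : Fin 3 → OneForm abpModel (M × (ℝ × ℝ × ℝ)) :=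
  let K₁ : M → ℝ := curv₁ θ₁ θ₂
  let K₂ : M → ℝ := curv₂ θ₁ θ₂
  let K₁₁ : M → ℝ := coeff₁ θ₁ θ₂ K₁
  let K₂₂ : M → ℝ := coeff₂ θ₁ θ₂ K₂
  ![fun q => mvfderiv abpModel (fun q : M × (ℝ × ℝ × ℝ) => q.2.1) q
      - ((2 * q.2.1 + q.2.2.2 + 1) • lift θ₁ q
        + (2 * q.2.1 * (1 - K₁ q.1)) • lift θ₂ q),
    fun q => mvfderiv abpModel (fun q : M × (ℝ × ℝ × ℝ) => q.2.2.1) q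
      - ((2 * q.2.2.1 * (1 - K₂ q.1)) • lift θ₁ q
        + (2 * q.2.2.1 - q.2.2.2 + 1) • lift θ₂ q),
    fun q => mvfderiv abpModel (fun q : M × (ℝ × ℝ × ℝ) => q.2.2.2) q
      - (((2 - K₂ q.1) * (q.2.2.2 - 1)
            + 2 * (K₁ q.1 - K₂ q.1 - K₁ q.1 * K₂ q.1 + K₂₂ q.1) * q.2.2.1) • lift θ₁ q
        + ((2 - K₁ q.1) * (q.2.2.2 + 1)
            + 2 * (K₁ q.1 - K₂ q.1 + K₁ q.1 * K₂ q.1 - K₁₁ q.1) * q.2.1) • lift θ₂ q)]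

/-- The `(a, b, p)` system of the coframing `(θ₁, θ₂)` is Frobenius over `D`. -/
def AbpFrobeniusOn (θ₁ θ₂ : OneForm (𝓡 2) M) (D : Set M) : Prop :=
  ∀ q : M × (ℝ × ℝ × ℝ), q.1 ∈ D → IsFrobeniusAt (abpSystem θ₁ θ₂) q

end ShapeOperator

end

open ShapeOperator

open scoped Topology

noncomputable section

/-! Subscripts 1 and 2 denote the components along θ₁ and θ₂ of a differential (`coeff₁`, `coeff₂`).
Put α = K₁ - K₂ + K₁K₂ - K₁₁ and β = K₁ - K₂ - K₁K₂ + K₂₂. Modulo the system, the exterior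
derivatives of the first two Pfaffian forms vanish identically, and that of the third is a multiple
of θ₁ ∧ θ₂ whose coefficient is, up to sign, `abpObstruction`, an affine function of (a, b, p) over
each point of D. So the Frobenius condition says that the coefficients of this affine function
vanish (`abpFrobeniusOn_iff`), which amounts to K₁₁ = ⅔(K₁ - 1)(K₂ + 2), K₂₂ = ⅔(K₂ - 1)(K₁ + 2), α₁
= 0, β₂ = 0. With the first two equations, J = (K₁ - 1)(K₂ - 1) equals both 3α - 3 and -3β - 3.
Hence J₁ = J₂ = 0, and J is constant on a connected D.

If J ≠ 0, then J₁ = J₂ = 0 can be solved for K₂₁ and K₁₂. The identity d(dK₁) = 0 (`coeff_comm`)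
becomes (K₁ + 2)(K₂ + 2) = 0, and differentiating this once more forces K₁ = K₂ = -2, which is (II).

If J = 0, the equation for K₁₁ is linear in K₁ - 1 along the curves θ₂ = 0, so the zero set of K₁ -
1 is invariant along them; likewise the zero set of K₂ - 1 is invariant along the curves θ₁ = 0.
Were neither function zero near a point, a curve of the first family on which K₁ ≠ 1 would cross one
of the second on which K₂ ≠ 1, contradicting J = 0 at the crossing
(`eventually_eq_zero_of_mul_eq_zero`). So D is covered by the interiors of {K₁ = 1} and {K₂ = 1},
where (I) and (I*) hold.

Conversely, each of the three systems makes α and β constant and annihilates the remaining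
coefficients of the obstruction. -/

namespace ShapeOperator

/-! ### Exterior calculus of one-forms on a manifold: Leibniz rule, pullbacks, closedness of exact
forms. -/

section FormCalculus

section Calculus

variable {E : Type*} [NormedAddCommGroup E] [NormedSpace ℝ E]
  {H : Type*} [TopologicalSpace H] {I : ModelWithCorners ℝ E H}
  {N : Type*} [TopologicalSpace N] [ChartedSpace H N]
  {E' : Type*} [NormedAddCommGroup E'] [NormedSpace ℝ E']
  {H' : Type*} [TopologicalSpace H'] {I' : ModelWithCorners ℝ E' H'}
  {N' : Type*} [TopologicalSpace N'] [ChartedSpace H' N']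

/-- The one-form `φ` is differentiable at `x`, read in the preferred chart at `x`. -/
def FormDiffAt (φ : OneForm I N) (x : N) : Prop :=
  DifferentiableAt ℝ (chartForm φ x) (extChartAt I x x)

theorem tendsto_extChartAt_symm [I.Boundaryless] (x : N) :
    Filter.Tendsto (extChartAt I x).symm (𝓝 (extChartAt I x x)) (𝓝 x) := by
  have := (continuousAt_extChartAt_symm (I := I) x).tendsto
  rwa [extChartAt_to_inv] at this

theorem extD_eq_of_chartForm_eventuallyEq {φ ψ : OneForm I N} {x : N}
    (h : chartForm φ x =ᶠ[𝓝 (extChartAt I x x)] chartForm ψ x) (v w : TangentSpace I x) :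
    extD φ x v w = extD ψ x v w := by
  unfold extD
  rw [h.extDeriv_eq]

theorem chartForm_eventuallyEq [I.Boundaryless] {φ ψ : OneForm I N} {x : N}
    (h : ∀ᶠ y in 𝓝 x, φ y = ψ y) :
    chartForm φ x =ᶠ[𝓝 (extChartAt I x x)] chartForm ψ x := by
  filter_upwards [(tendsto_extChartAt_symm (I := I) x).eventually h] with u hu
  simp only [chartForm, hu]

theorem extD_congr [I.Boundaryless] {φ ψ : OneForm I N} {x : N}
    (h : ∀ᶠ y in 𝓝 x, φ y = ψ y) (v w : TangentSpace I x) :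
    extD φ x v w = extD ψ x v w :=
  extD_eq_of_chartForm_eventuallyEq (chartForm_eventuallyEq h) v w

theorem chartForm_add (φ ψ : OneForm I N) (x : N) :
    chartForm (fun y => φ y + ψ y) x = chartForm φ x + chartForm ψ x := by
  rfl

theorem chartForm_sub (φ ψ : OneForm I N) (x : N) :
    chartForm (fun y => φ y - ψ y) x = chartForm φ x - chartForm ψ x := by
  rfl

theorem chartForm_smul (f : N → ℝ) (φ : OneForm I N) (x : N) :
    chartForm (fun y => f y • φ y) x =
      fun u => (f ∘ (extChartAt I x).symm) u • chartForm φ x u := by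
  rfl

theorem FormDiffAt.add {φ ψ : OneForm I N} {x : N} (hφ : FormDiffAt φ x) (hψ : FormDiffAt ψ x) :
    FormDiffAt (fun y => φ y + ψ y) x := by
  unfold FormDiffAt
  rw [chartForm_add]
  exact DifferentiableAt.add hφ hψ

theorem differentiableAt_comp_extChartAt_symm [I.Boundaryless] {f : N → ℝ} {x : N}
    (hf : MDifferentiableAt I 𝓘(ℝ, ℝ) f x) :
    DifferentiableAt ℝ (f ∘ (extChartAt I x).symm) (extChartAt I x x) := by
  have := hf.differentiableWithinAt_writtenInExtChartAt
  rw [I.range_eq_univ, differentiableWithinAt_univ] at this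
  exact this

theorem mvfderiv_eq_fderiv [I.Boundaryless] {f : N → ℝ} {x : N}
    (hf : MDifferentiableAt I 𝓘(ℝ, ℝ) f x) (v : TangentSpace I x) :
    mvfderiv I f x v = fderiv ℝ (f ∘ (extChartAt I x).symm) (extChartAt I x x) v := by
  have h : mfderiv I 𝓘(ℝ, ℝ) f x =
      fderivWithin ℝ (writtenInExtChartAt I 𝓘(ℝ, ℝ) x f) (range I) (extChartAt I x x) :=
    hf.mfderiv
  have h2 : mvfderiv I f x v = mfderiv I 𝓘(ℝ, ℝ) f x v := rfl
  rw [h2, h, I.range_eq_univ, fderivWithin_univ]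
  rfl

theorem FormDiffAt.smul [I.Boundaryless] {f : N → ℝ} {φ : OneForm I N} {x : N}
    (hf : MDifferentiableAt I 𝓘(ℝ, ℝ) f x) (hφ : FormDiffAt φ x) :
    FormDiffAt (fun y => f y • φ y) x := by
  unfold FormDiffAt
  rw [chartForm_smul]
  exact (differentiableAt_comp_extChartAt_symm hf).smul hφ

theorem extD_add {φ ψ : OneForm I N} {x : N} (hφ : FormDiffAt φ x) (hψ : FormDiffAt ψ x)
    (v w : TangentSpace I x) :
    extD (fun y => φ y + ψ y) x v w = extD φ x v w + extD ψ x v w := by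
  unfold extD
  rw [chartForm_add, extDeriv_add hφ hψ]
  rfl

theorem chartForm_self [IsManifold I 1 N] [I.Boundaryless] (φ : OneForm I N) (x : N)
    (V : Fin 1 → E) : chartForm φ x (extChartAt I x x) V = φ x (V 0) := by
  have h := mfderivWithin_extChartAt_symm_comp_mfderiv_extChartAt' (I := I)
    (mem_extChartAt_source (I := I) x)
  rw [mfderiv_extChartAt_self, I.range_eq_univ, mfderivWithin_univ] at h
  have h2 : mfderiv 𝓘(ℝ, E) I (extChartAt I x).symm (extChartAt I x x) (V 0) = V 0 :=
    DFunLike.congr_fun h (V 0)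
  -- The base points agree only propositionally, so the tangent vectors are compared as elements of
  -- the common model space `E`.
  have key : ∀ (z : N) (_ : z = x) (a b : E), a = b →
      φ z (show TangentSpace I z from a) = φ x (show TangentSpace I x from b) := by
    rintro z rfl a b rfl
    rfl
  exact key _ (extChartAt_to_inv x) _ _ h2

theorem extDeriv_apply_pair (η : E → E [⋀^Fin 1]→L[ℝ] ℝ) (p : E) (V W : E) :
    extDeriv η p ![V, W] = fderiv ℝ η p V ![W] - fderiv ℝ η p W ![V] := by
  have h0 : Fin.removeNth 0 ![V, W] = ![W] := by
    ext i
    fin_cases i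
    rfl
  have h1 : Fin.removeNth 1 ![V, W] = ![V] := by
    ext i
    fin_cases i
    rfl
  rw [extDeriv, ContinuousAlternatingMap.alternatizeUncurryFin_apply, Fin.sum_univ_two, h0, h1]
  simp [sub_eq_add_neg]

/-- The chart at `x` has the identity as its derivative at `x`, so the pullback in `extD` disappears
and ordinary derivative rules apply. -/
theorem extD_eq [IsManifold I 1 N] (φ : OneForm I N) (x : N) (v w : TangentSpace I x) :
    extD φ x v w = fderiv ℝ (chartForm φ x) (extChartAt I x x) v ![w]
      - fderiv ℝ (chartForm φ x) (extChartAt I x x) w ![v] := by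
  unfold extD
  rw [mfderiv_extChartAt_self]
  exact extDeriv_apply_pair _ _ _ _

theorem extD_sub [IsManifold I 1 N] {φ ψ : OneForm I N} {x : N} (hφ : FormDiffAt φ x)
    (hψ : FormDiffAt ψ x) (v w : TangentSpace I x) :
    extD (fun y => φ y - ψ y) x v w = extD φ x v w - extD ψ x v w := by
  simp only [extD_eq]
  have e : ∀ (P Q : E →L[ℝ] E [⋀^Fin 1]→L[ℝ] ℝ) (a b : E),
      (P - Q) a ![b] = P a ![b] - Q a ![b] := fun _ _ _ _ => rfl
  rw [chartForm_sub, fderiv_sub hφ hψ]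
  erw [e, e]
  ring

theorem extD_smul [IsManifold I 1 N] [I.Boundaryless] {f : N → ℝ} {φ : OneForm I N} {x : N}
    (hf : MDifferentiableAt I 𝓘(ℝ, ℝ) f x) (hφ : FormDiffAt φ x) (v w : TangentSpace I x) :
    extD (fun y => f y • φ y) x v w =
      wedge (mvfderiv I f x) (φ x) v w + f x * extD φ x v w := by
  have hf' := differentiableAt_comp_extChartAt_symm hf
  have hφ' : DifferentiableAt ℝ (chartForm φ x) (extChartAt I x x) := hφ
  have hfx : (f ∘ (extChartAt I x).symm) (extChartAt I x x) = f x := by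
    rw [Function.comp_apply, extChartAt_to_inv]
  simp only [extD_eq, wedge, mvfderiv_eq_fderiv hf]
  rw [chartForm_smul, fderiv_fun_smul hf' hφ', hfx]
  have e : ∀ a b : E, (f x • fderiv ℝ (chartForm φ x) (extChartAt I x x) +
      (fderiv ℝ (f ∘ (extChartAt I x).symm) (extChartAt I x x)).smulRight
        (chartForm φ x (extChartAt I x x))) a ![b] =
      f x * fderiv ℝ (chartForm φ x) (extChartAt I x x) a ![b] +
        fderiv ℝ (f ∘ (extChartAt I x).symm) (extChartAt I x x) a * φ x b := by
    intro a b
    rw [← show chartForm φ x (extChartAt I x x) ![b] = φ x b from chartForm_self φ x ![b]]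
    rfl
  erw [e, e]
  ring

/-- Invariance of the exterior derivative: the exterior derivative of the pullback of `φ` by `F`
is computed in any chart around the image point. -/
theorem extD_pullback [IsManifold I ∞ N] [IsManifold I' ∞ N'] [I.Boundaryless] [I'.Boundaryless]
    {F : N → N'} {φ : OneForm I' N'} {x : N} {y : N'} (hy : F x ∈ (extChartAt I' y).source)
    (hF : ContMDiffAt I I' ∞ F x)
    (hφ : DifferentiableAt ℝ (chartForm φ y) (extChartAt I' y (F x))) :
    FormDiffAt (fun z => (φ (F z)).comp (mfderiv I I' F z) : OneForm I N) x ∧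
    ∀ v w : TangentSpace I x,
      extD (fun z => (φ (F z)).comp (mfderiv I I' F z) : OneForm I N) x v w =
        extDeriv (chartForm φ y) (extChartAt I' y (F x))
          ![mfderiv I' 𝓘(ℝ, E') (extChartAt I' y) (F x) (mfderiv I I' F x v),
            mfderiv I' 𝓘(ℝ, E') (extChartAt I' y) (F x) (mfderiv I I' F x w)] := by
  set τ : E → E' := extChartAt I' y ∘ F ∘ (extChartAt I x).symm with hτ
  set p := extChartAt I x x with hp
  have hxp : (extChartAt I x).symm p = x := extChartAt_to_inv x
  have hτp : τ p = extChartAt I' y (F x) := by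
    simp only [hτ, Function.comp_apply, hxp]
  have hsymm : ∀ u ∈ (extChartAt I x).target,
      ContMDiffAt 𝓘(ℝ, E) I ∞ (extChartAt I x).symm u := fun u hu =>
    (contMDiffOn_extChartAt_symm x).contMDiffAt
      ((isOpen_extChartAt_target x).mem_nhds hu)
  have hchart : ∀ z ∈ (extChartAt I' y).source,
      ContMDiffAt I' 𝓘(ℝ, E') ∞ (extChartAt I' y) z := fun z hz =>
    contMDiffAt_extChartAt' (by rwa [extChartAt_source] at hz)
  have hchart_symm : ∀ u ∈ (extChartAt I' y).target,
      ContMDiffAt 𝓘(ℝ, E') I' ∞ (extChartAt I' y).symm u := fun u hu =>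
    (contMDiffOn_extChartAt_symm y).contMDiffAt
      ((isOpen_extChartAt_target y).mem_nhds hu)
  have hone : (1 : WithTop ℕ∞) ≤ ∞ := by norm_cast
  have h0 : (∞ : WithTop ℕ∞) ≠ 0 := by simp
  have hpt : p ∈ (extChartAt I x).target := mem_extChartAt_target x
  have hmτ : ContMDiffAt 𝓘(ℝ, E) 𝓘(ℝ, E') ∞ τ p := by
    refine ContMDiffAt.comp p (I' := I') (hchart _ ?_) (ContMDiffAt.comp p (I' := I) ?_
      (hsymm p hpt))
    · rw [Function.comp_apply, hxp]
      exact hy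
    · rw [hxp]
      exact hF
  have hcτ : ContDiffAt ℝ ∞ τ p := contMDiffAt_iff_contDiffAt.1 hmτ
  -- In coordinates the pullback by `F` is the pullback by the coordinate map `τ`; this is the chain
  -- rule at every point near `p`.
  have hev : chartForm (fun z => (φ (F z)).comp (mfderiv I I' F z) : OneForm I N) x =ᶠ[𝓝 p]
      fun u => (chartForm φ y (τ u)).compContinuousLinearMap (fderiv ℝ τ u) := by
    have e1 : ∀ᶠ u in 𝓝 p, u ∈ (extChartAt I x).target :=
      (isOpen_extChartAt_target x).mem_nhds hpt
    have e2 : ∀ᶠ u in 𝓝 p, ContMDiffAt I I' 1 F ((extChartAt I x).symm u) :=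
      (tendsto_extChartAt_symm x).eventually (contMDiffAt_iff_contMDiffAt_nhds (by simp) |>.1 (hF.of_le hone))
    have e3 : ∀ᶠ u in 𝓝 p, F ((extChartAt I x).symm u) ∈ (extChartAt I' y).source :=
      (tendsto_extChartAt_symm x).eventually
        (hF.continuousAt.eventually_mem ((isOpen_extChartAt_source y).mem_nhds hy))
    have e4 : ∀ᶠ u in 𝓝 p, DifferentiableAt ℝ τ u :=
      ((hcτ.of_le hone).eventually (by simp)).mono fun u hu => hu.differentiableAt (by simp)
    filter_upwards [e1, e2, e3, e4, e3.eventually_nhds] with u h1 h2 h3 h4 h5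
    have hb : (extChartAt I' y).symm (τ u) = F ((extChartAt I x).symm u) :=
      (extChartAt I' y).left_inv h3
    have ht : τ u ∈ (extChartAt I' y).target := (extChartAt I' y).map_source h3
    have hc1 : mfderiv 𝓘(ℝ, E) I' ((extChartAt I' y).symm ∘ τ) u =
        (mfderiv 𝓘(ℝ, E') I' (extChartAt I' y).symm (τ u)).comp
          (mfderiv 𝓘(ℝ, E) 𝓘(ℝ, E') τ u) :=
      mfderiv_comp u ((hchart_symm _ ht).mdifferentiableAt h0) h4.mdifferentiableAt
    have hc2 : mfderiv 𝓘(ℝ, E) I' (F ∘ (extChartAt I x).symm) u =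
        (mfderiv I I' F ((extChartAt I x).symm u)).comp
          (mfderiv 𝓘(ℝ, E) I (extChartAt I x).symm u) :=
      mfderiv_comp u (h2.mdifferentiableAt (by simp)) ((hsymm u h1).mdifferentiableAt h0)
    have hc3 : mfderiv 𝓘(ℝ, E) I' ((extChartAt I' y).symm ∘ τ) u =
        mfderiv 𝓘(ℝ, E) I' (F ∘ (extChartAt I x).symm) u := by
      refine Filter.EventuallyEq.mfderiv_eq ?_
      filter_upwards [h5] with u' hu'
      exact (extChartAt I' y).left_inv hu'
    rw [mfderiv_eq_fderiv] at hc1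
    have key : ∀ (z z' : N') (_ : z = z') (a b : E'), a = b →
        φ z (show TangentSpace I' z from a) = φ z' (show TangentSpace I' z' from b) := by
      rintro z _ rfl a b rfl
      rfl
    ext V
    refine key _ _ hb.symm _ _ ?_
    have := DFunLike.congr_fun ((hc2.symm.trans hc3.symm).trans hc1) (V 0)
    exact this
  have hφ' : DifferentiableAt ℝ (chartForm φ y) (τ p) := by rwa [hτp]
  have hdτ : ∀ v : TangentSpace I x, fderiv ℝ τ p v =
      mfderiv I' 𝓘(ℝ, E') (extChartAt I' y) (F x) (mfderiv I I' F x v) := by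
    intro v
    have hc1 : mfderiv I 𝓘(ℝ, E') (τ ∘ extChartAt I x) x =
        (mfderiv 𝓘(ℝ, E) 𝓘(ℝ, E') τ p).comp (mfderiv I 𝓘(ℝ, E) (extChartAt I x) x) :=
      mfderiv_comp x (hmτ.mdifferentiableAt h0)
        ((contMDiffAt_extChartAt (n := ∞)).mdifferentiableAt h0)
    have hc2 : mfderiv I 𝓘(ℝ, E') (extChartAt I' y ∘ F) x =
        (mfderiv I' 𝓘(ℝ, E') (extChartAt I' y) (F x)).comp (mfderiv I I' F x) :=
      mfderiv_comp x ((hchart _ hy).mdifferentiableAt h0) (hF.mdifferentiableAt h0)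
    have hc3 : mfderiv I 𝓘(ℝ, E') (τ ∘ extChartAt I x) x =
        mfderiv I 𝓘(ℝ, E') (extChartAt I' y ∘ F) x := by
      refine Filter.EventuallyEq.mfderiv_eq ?_
      filter_upwards [(isOpen_extChartAt_source (I := I) x).mem_nhds (mem_extChartAt_source x)]
        with z hz
      simp only [hτ, Function.comp_apply, (extChartAt I x).left_inv hz]
    rw [mfderiv_extChartAt_self, mfderiv_eq_fderiv] at hc1
    exact DFunLike.congr_fun ((hc1.symm.trans hc3).trans hc2) v
  -- Commuting d with a pullback rests on symmetry of second derivatives, hence the C² requirement.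
  have h2 : minSmoothness ℝ 2 ≤ (∞ : WithTop ℕ∞) := by
    simp only [minSmoothness_of_isRCLikeNormedField]
    exact WithTop.coe_le_coe.2 (le_top : (2 : ℕ∞) ≤ ⊤)
  refine ⟨?_, fun v w => ?_⟩
  · refine DifferentiableAt.congr_of_eventuallyEq ?_ hev
    exact (hφ'.comp p (hcτ.differentiableAt h0)).continuousAlternatingMapCompContinuousLinearMap
      ((hcτ.fderiv_right (m := 1) (by norm_cast)).differentiableAt (by simp))
  · unfold extD
    rw [hev.extDeriv_eq, extDeriv_pullback hφ' hcτ h2, hτp, mfderiv_extChartAt_self, ← hdτ, ← hdτ]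
    rw [ContinuousAlternatingMap.compContinuousLinearMap_apply]
    congr 1
    ext i
    fin_cases i <;> rfl

/-- The form dt on the line has constant coefficients in its chart, hence is closed; closedness of
df follows by pulling dt back along f. -/
theorem chartForm_line (t : ℝ) :
    chartForm (I := 𝓘(ℝ, ℝ)) (N := ℝ) (fun _ => ContinuousLinearMap.id ℝ ℝ) t =
      fun _ => ContinuousAlternatingMap.ofSubsingleton ℝ ℝ ℝ (0 : Fin 1)
        (ContinuousLinearMap.id ℝ ℝ) := by
  funext u
  have h : mfderiv 𝓘(ℝ, ℝ) 𝓘(ℝ, ℝ) (extChartAt 𝓘(ℝ, ℝ) t).symm u = ContinuousLinearMap.id ℝ ℝ := by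
    rw [extChartAt_model_space_eq_id, mfderiv_eq_fderiv]
    exact fderiv_id
  exact ContinuousAlternatingMap.ext fun V => DFunLike.congr_fun h (V 0)

/-- The differential of a smooth function is a closed form. -/
theorem extD_mvfderiv [IsManifold I ∞ N] [I.Boundaryless] {f : N → ℝ} {x : N}
    (hf : ContMDiffAt I 𝓘(ℝ, ℝ) ∞ f x) :
    FormDiffAt (mvfderiv I f) x ∧ ∀ v w, extD (mvfderiv I f) x v w = 0 := by
  have h := extD_pullback (I := I) (I' := 𝓘(ℝ, ℝ)) (F := f)
    (φ := fun _ => ContinuousLinearMap.id ℝ ℝ) (x := x) (y := f x) (mem_extChartAt_source _) hf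
    (by rw [chartForm_line]; exact differentiableAt_const _)
  refine ⟨h.1, fun v w => (h.2 v w).trans ?_⟩
  rw [chartForm_line, extDeriv, fderiv_const_apply]
  have : ContinuousAlternatingMap.alternatizeUncurryFin
      (0 : ℝ →L[ℝ] ℝ [⋀^Fin 1]→L[ℝ] ℝ) = 0 := by
    refine ContinuousAlternatingMap.ext fun V => ?_
    simp [ContinuousAlternatingMap.alternatizeUncurryFin_apply]
  rw [this]
  rfl

end Calculus

end FormCalculus

/-! ### Coframings of a surface: components, smoothness of the invariants, and d(df) = 0. -/

section SurfaceCoframing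

section Planar

/-- The standard basis vectors of the model plane. -/
def planeBasis (i : Fin 2) : Plane := EuclideanSpace.single i (1 : ℝ)

/-- A function of two vectors of the plane is a multiple of the area form. -/
def IsAreaMultiple (Ω : Plane → Plane → ℝ) : Prop :=
  ∀ v w, Ω v w = Ω (planeBasis 0) (planeBasis 1) * (v 0 * w 1 - v 1 * w 0)

theorem plane_eq_sum (v : Plane) : v = v 0 • planeBasis 0 + v 1 • planeBasis 1 := by
  ext i
  fin_cases i <;> simp [planeBasis]

theorem isAreaMultiple_wedge (α β : Plane →L[ℝ] ℝ) :
    IsAreaMultiple fun v w => α v * β w - α w * β v := by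
  intro v w
  have h : ∀ (γ : Plane →L[ℝ] ℝ) (u : Plane),
      γ u = u 0 * γ (planeBasis 0) + u 1 * γ (planeBasis 1) := by
    intro γ u
    conv_lhs => rw [plane_eq_sum u]
    simp
  change α v * β w - α w * β v = (α (planeBasis 0) * β (planeBasis 1) -
    α (planeBasis 1) * β (planeBasis 0)) * (v 0 * w 1 - v 1 * w 0)
  rw [h α v, h β v, h α w, h β w]
  ring

/-- Cramer's rule for covectors of the plane. -/
theorem eq_cramer_of_ne (α β γ : Plane →L[ℝ] ℝ)
    (hne : β (planeBasis 0) * γ (planeBasis 1) - β (planeBasis 1) * γ (planeBasis 0) ≠ 0) :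
    α = ((α (planeBasis 0) * γ (planeBasis 1) - α (planeBasis 1) * γ (planeBasis 0)) /
        (β (planeBasis 0) * γ (planeBasis 1) - β (planeBasis 1) * γ (planeBasis 0))) • β +
      ((β (planeBasis 0) * α (planeBasis 1) - β (planeBasis 1) * α (planeBasis 0)) /
        (β (planeBasis 0) * γ (planeBasis 1) - β (planeBasis 1) * γ (planeBasis 0))) • γ := by
  ext v
  have h : ∀ (δ : Plane →L[ℝ] ℝ), δ v = v 0 * δ (planeBasis 0) + v 1 * δ (planeBasis 1) := by
    intro δ
    conv_lhs => rw [plane_eq_sum v]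
    simp
  change α v = _ / _ * β v + _ / _ * γ v
  rw [div_mul_eq_mul_div, div_mul_eq_mul_div, ← add_div, eq_div_iff hne, h α, h β, h γ]
  ring

/-- Alternating two-forms on a plane are a line spanned by the determinant. -/
theorem isAreaMultiple_alternating (η : Plane [⋀^Fin 2]→L[ℝ] ℝ) :
    IsAreaMultiple fun v w => η ![v, w] := by
  intro v w
  have hb : ((EuclideanSpace.basisFun (Fin 2) ℝ).toBasis : Fin 2 → Plane) =
      ![planeBasis 0, planeBasis 1] := by
    ext i j
    fin_cases i <;> simp [planeBasis]
  have h := DFunLike.congr_fun (η.toAlternatingMap.eq_smul_basis_det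
    (EuclideanSpace.basisFun (Fin 2) ℝ).toBasis) ![v, w]
  rw [hb] at h
  refine h.trans ?_
  rw [AlternatingMap.smul_apply, smul_eq_mul, Module.Basis.det_apply, Matrix.det_fin_two]
  simp [Module.Basis.toMatrix_apply]
  left
  ring

/-- The cross-multiplied form of the fact that the quotient of two area multiples does not depend on
the vectors; it makes `ratio` independent of basis and chart. -/
theorem IsAreaMultiple.mul_comm {Ω W : Plane → Plane → ℝ} (hΩ : IsAreaMultiple Ω)
    (hW : IsAreaMultiple W) (v w v' w' : Plane) : Ω v w * W v' w' = Ω v' w' * W v w := by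
  rw [hΩ v w, hW v' w', hΩ v' w', hW v w]
  ring

end Planar

variable {M : Type*} [TopologicalSpace M] [ChartedSpace Plane M]

theorem isAreaMultiple_wedge_tangent {x : M} (α β : TangentSpace (𝓡 2) x →L[ℝ] ℝ) :
    IsAreaMultiple (wedge α β) :=
  isAreaMultiple_wedge α β

/-- A form is smooth at `x` if it is smooth in the preferred chart at `x`. -/
def SmoothFormAt (φ : OneForm (𝓡 2) M) (x : M) : Prop :=
  ContDiffAt ℝ ∞ (chartForm φ x) (extChartAt (𝓡 2) x x)

theorem SmoothFormAt.formDiffAt {φ : OneForm (𝓡 2) M} {x : M} (h : SmoothFormAt φ x) :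
    FormDiffAt φ x :=
  h.differentiableAt (by simp)

/-- Coordinate expression of the wedge product of two forms. -/
def chartWedge (φ ψ : OneForm (𝓡 2) M) (x : M) (u : Plane) (v w : Plane) : ℝ :=
  chartForm φ x u ![v] * chartForm ψ x u ![w] - chartForm φ x u ![w] * chartForm ψ x u ![v]

theorem isAreaMultiple_chartWedge (φ ψ : OneForm (𝓡 2) M) (x : M) (u : Plane) :
    IsAreaMultiple (chartWedge φ ψ x u) := by
  exact isAreaMultiple_wedge
    ((φ ((extChartAt (𝓡 2) x).symm u)).comp (mfderiv 𝓘(ℝ, Plane) (𝓡 2) (extChartAt (𝓡 2) x).symm u))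
    ((ψ ((extChartAt (𝓡 2) x).symm u)).comp (mfderiv 𝓘(ℝ, Plane) (𝓡 2) (extChartAt (𝓡 2) x).symm u))

theorem contDiffAt_chartForm_apply {φ : OneForm (𝓡 2) M} {x : M} (h : SmoothFormAt φ x)
    (V : Fin 1 → Plane) :
    ContDiffAt ℝ ∞ (fun u => chartForm φ x u V) (extChartAt (𝓡 2) x x) :=
  (ContinuousAlternatingMap.apply ℝ Plane ℝ V).contDiff.contDiffAt.comp _ h

theorem contDiffAt_chartWedge {φ ψ : OneForm (𝓡 2) M} {x : M} (hφ : SmoothFormAt φ x)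
    (hψ : SmoothFormAt ψ x) (v w : Plane) :
    ContDiffAt ℝ ∞ (fun u => chartWedge φ ψ x u v w) (extChartAt (𝓡 2) x x) :=
  ((contDiffAt_chartForm_apply hφ _).mul (contDiffAt_chartForm_apply hψ _)).sub
    ((contDiffAt_chartForm_apply hφ _).mul (contDiffAt_chartForm_apply hψ _))

theorem contMDiffAt_comp_extChartAt {k : Plane → ℝ} {x : M}
    (hk : ContDiffAt ℝ ∞ k (extChartAt (𝓡 2) x x)) :
    ContMDiffAt (𝓡 2) 𝓘(ℝ, ℝ) ∞ (fun y => k (extChartAt (𝓡 2) x y)) x :=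
  ContMDiffAt.comp x (I' := 𝓘(ℝ, Plane)) hk.contMDiffAt contMDiffAt_extChartAt

/-- A pair of smooth one-forms, linearly independent at each point of `D`. -/
structure IsCoframing (θ₁ θ₂ : OneForm (𝓡 2) M) (D : Set M) : Prop where
  isOpen : IsOpen D
  smooth₁ : ∀ x ∈ D, SmoothFormAt θ₁ x
  smooth₂ : ∀ x ∈ D, SmoothFormAt θ₂ x
  ne : ∀ x ∈ D, wedge (θ₁ x) (θ₂ x) (tangentBasis x 0) (tangentBasis x 1) ≠ 0

section Coframing

variable {θ₁ θ₂ : OneForm (𝓡 2) M} {D : Set M}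

theorem IsCoframing.eventually_mem (hθ : IsCoframing θ₁ θ₂ D) {x : M} (hx : x ∈ D) :
    ∀ᶠ y in 𝓝 x, y ∈ D ∧ y ∈ (extChartAt (𝓡 2) x).source :=
  Filter.Eventually.and (hθ.isOpen.mem_nhds hx)
    ((isOpen_extChartAt_source (I := 𝓡 2) x).mem_nhds (mem_extChartAt_source x))

theorem eq_ratio_mul_wedge (hθ : IsCoframing θ₁ θ₂ D) {x : M} (hx : x ∈ D)
    {Ω : TangentSpace (𝓡 2) x → TangentSpace (𝓡 2) x → ℝ} (hΩ : IsAreaMultiple Ω)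
    (v w : TangentSpace (𝓡 2) x) :
    Ω v w = ratio θ₁ θ₂ x Ω * wedge (θ₁ x) (θ₂ x) v w := by
  have h := hΩ.mul_comm (isAreaMultiple_wedge_tangent (θ₁ x) (θ₂ x)) v w (planeBasis 0)
    (planeBasis 1)
  rw [ratio, div_mul_eq_mul_div, eq_div_iff (hθ.ne x hx)]
  exact h

theorem ratio_unique (hθ : IsCoframing θ₁ θ₂ D) {x : M} (hx : x ∈ D)
    {Ω : TangentSpace (𝓡 2) x → TangentSpace (𝓡 2) x → ℝ} {c : ℝ}
    (h : ∀ v w, Ω v w = c * wedge (θ₁ x) (θ₂ x) v w) : ratio θ₁ θ₂ x Ω = c := by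
  rw [ratio, h, mul_div_assoc, div_self (hθ.ne x hx), mul_one]

theorem wedge_swap {x : M} (α β : TangentSpace (𝓡 2) x →L[ℝ] ℝ) (v w : TangentSpace (𝓡 2) x) :
    wedge β α v w = -wedge α β v w := by
  unfold wedge
  ring

/-- Cramer's rule: a covector is the combination of `θ₁` and `θ₂` given by the ratios. -/
theorem mvfderiv_eq_coeff (hθ : IsCoframing θ₁ θ₂ D) {x : M} (hx : x ∈ D) (f : M → ℝ) :
    mvfderiv (𝓡 2) f x = coeff₁ θ₁ θ₂ f x • θ₁ x + coeff₂ θ₁ θ₂ f x • θ₂ x := by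
  exact eq_cramer_of_ne (mvfderiv (𝓡 2) f x) (θ₁ x) (θ₂ x) (hθ.ne x hx)

theorem coeff₁_eq (hθ : IsCoframing θ₁ θ₂ D) {x : M} (hx : x ∈ D) {f : M → ℝ} {a b : ℝ}
    (h : mvfderiv (𝓡 2) f x = a • θ₁ x + b • θ₂ x) : coeff₁ θ₁ θ₂ f x = a :=
  ratio_unique hθ hx fun v w => by
    have e : ∀ u, mvfderiv (𝓡 2) f x u = a * θ₁ x u + b * θ₂ x u := DFunLike.congr_fun h
    unfold wedge
    rw [e, e]
    ring

theorem coeff₂_eq (hθ : IsCoframing θ₁ θ₂ D) {x : M} (hx : x ∈ D) {f : M → ℝ} {a b : ℝ}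
    (h : mvfderiv (𝓡 2) f x = a • θ₁ x + b • θ₂ x) : coeff₂ θ₁ θ₂ f x = b :=
  ratio_unique hθ hx fun v w => by
    have e : ∀ u, mvfderiv (𝓡 2) f x u = a * θ₁ x u + b * θ₂ x u := DFunLike.congr_fun h
    unfold wedge
    rw [e, e]
    ring

theorem curv₁_eq (hθ : IsCoframing θ₁ θ₂ D) {x : M} (hx : x ∈ D) {c : ℝ}
    (h : ∀ v w, extD θ₁ x v w = c * wedge (θ₁ x) (θ₂ x) v w) : curv₁ θ₁ θ₂ x = c :=
  ratio_unique hθ hx h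

theorem curv₂_eq (hθ : IsCoframing θ₁ θ₂ D) {x : M} (hx : x ∈ D) {c : ℝ}
    (h : ∀ v w, extD θ₂ x v w = c * wedge (θ₂ x) (θ₁ x) v w) : curv₂ θ₁ θ₂ x = c := by
  have : ratio θ₁ θ₂ x (extD θ₂ x) = -c := ratio_unique hθ hx fun v w => by
    rw [h, wedge_swap (θ₁ x) (θ₂ x)]
    ring
  rw [curv₂, this, neg_neg]

end Coframing

/-- The derivative of the preferred chart at `x`, with values in the model plane. -/
def chartDiff (x y : M) : Plane →L[ℝ] Plane :=
  mfderiv (𝓡 2) 𝓘(ℝ, Plane) (extChartAt (𝓡 2) x) y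

/-- The ratio of two two-forms may be computed in any chart. -/
theorem ratio_eq_div {θ₁ θ₂ : OneForm (𝓡 2) M} {x y : M} {Ω : Plane → Plane → ℝ}
    {Ω' W' : Plane → Plane → ℝ} (hΩ' : IsAreaMultiple Ω') (hW' : IsAreaMultiple W')
    (hΩ : ∀ v w, Ω v w = Ω' (chartDiff x y v) (chartDiff x y w))
    (hW : ∀ v w, wedge (θ₁ y) (θ₂ y) v w = W' (chartDiff x y v) (chartDiff x y w))
    (hne : wedge (θ₁ y) (θ₂ y) (tangentBasis y 0) (tangentBasis y 1) ≠ 0) :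
    ratio θ₁ θ₂ y Ω = Ω' (planeBasis 0) (planeBasis 1) / W' (planeBasis 0) (planeBasis 1) := by
  have hW0 : wedge (θ₁ y) (θ₂ y) (tangentBasis y 0) (tangentBasis y 1) =
      W' (chartDiff x y (planeBasis 0)) (chartDiff x y (planeBasis 1)) := hW _ _
  have hΩ0 : Ω (tangentBasis y 0) (tangentBasis y 1) =
      Ω' (chartDiff x y (planeBasis 0)) (chartDiff x y (planeBasis 1)) := hΩ _ _
  rw [hW0] at hne
  have hne' : W' (planeBasis 0) (planeBasis 1) ≠ 0 := by
    intro h0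
    rw [hW', h0, zero_mul] at hne
    exact hne rfl
  change Ω (tangentBasis y 0) (tangentBasis y 1) /
    wedge (θ₁ y) (θ₂ y) (tangentBasis y 0) (tangentBasis y 1) = _
  rw [hΩ0, hW0, div_eq_div_iff hne hne', hΩ'.mul_comm hW']

/-- The covector at `u` of a one-form read in the chart at `x`. -/
def coordForm (φ : OneForm (𝓡 2) M) (x : M) (u : Plane) : Plane →L[ℝ] ℝ :=
  (φ ((extChartAt (𝓡 2) x).symm u)).comp (mfderiv 𝓘(ℝ, Plane) (𝓡 2) (extChartAt (𝓡 2) x).symm u)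

/-- Covectors and alternating forms in one variable are identified by a linear isometry, so
smoothness can be tested on either side. -/
theorem smoothFormAt_iff_coordForm {φ : OneForm (𝓡 2) M} {x : M} :
    SmoothFormAt φ x ↔ ContDiffAt ℝ ∞ (coordForm φ x) (extChartAt (𝓡 2) x x) :=
  (ContinuousAlternatingMap.ofSubsingletonLIE (𝕜 := ℝ) (E := Plane) (F := ℝ)
    (0 : Fin 1)).toContinuousLinearEquiv.comp_contDiffAt_iff (f := coordForm φ x)

variable [IsManifold (𝓡 2) ∞ M]

theorem isAreaMultiple_extD (φ : OneForm (𝓡 2) M) (x : M) : IsAreaMultiple (extD φ x) := by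
  have h : ∀ v w : Plane, extD φ x v w =
      extDeriv (chartForm φ x) (extChartAt (𝓡 2) x x) ![v, w] := fun v w =>
    (extD_eq φ x v w).trans (extDeriv_apply_pair _ _ _ _).symm
  intro v w
  have h' := isAreaMultiple_alternating
    (extDeriv (chartForm φ x) (extChartAt (𝓡 2) x x)) v w
  exact (h v w).trans (h'.trans (by rw [h]))

theorem form_apply_eq_chartForm (φ : OneForm (𝓡 2) M) {x y : M}
    (hy : y ∈ (extChartAt (𝓡 2) x).source) (v : TangentSpace (𝓡 2) y) :
    φ y v = chartForm φ x (extChartAt (𝓡 2) x y) ![chartDiff x y v] := by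
  have h := mfderivWithin_extChartAt_symm_comp_mfderiv_extChartAt' hy
  rw [(𝓡 2).range_eq_univ, mfderivWithin_univ] at h
  have h2 := DFunLike.congr_fun h v
  have key : ∀ (z z' : M) (_ : z = z') (a b : Plane), a = b →
      φ z (show TangentSpace (𝓡 2) z from a) = φ z' (show TangentSpace (𝓡 2) z' from b) := by
    rintro z _ rfl a b rfl
    rfl
  exact key _ _ ((extChartAt (𝓡 2) x).left_inv hy).symm _ _ h2.symm

/-- The definition of `extD` at `y` uses the chart at `y`, which varies with `y`. Naturality for the
identity map moves the computation to the fixed chart at `x`, where dependence on `y` is visibly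
smooth. -/
theorem extD_eq_extDeriv_chartForm {φ : OneForm (𝓡 2) M} {x y : M}
    (hy : y ∈ (extChartAt (𝓡 2) x).source)
    (hφ : DifferentiableAt ℝ (chartForm φ x) (extChartAt (𝓡 2) x y)) (v w : TangentSpace (𝓡 2) y) :
    extD φ y v w = extDeriv (chartForm φ x) (extChartAt (𝓡 2) x y)
      ![chartDiff x y v, chartDiff x y w] := by
  have h := (extD_pullback (I := 𝓡 2) (I' := 𝓡 2) (F := id) (φ := φ) (x := y) (y := x) hy
    contMDiffAt_id hφ).2 v w
  have e : (fun z => (φ (id z)).comp (mfderiv (𝓡 2) (𝓡 2) id z) : OneForm (𝓡 2) M) = φ := by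
    funext z
    rw [mfderiv_id]
    rfl
  rw [e] at h
  refine h.trans ?_
  rw [mfderiv_id]
  rfl

theorem wedge_eq_chartWedge (φ ψ : OneForm (𝓡 2) M) {x y : M}
    (hy : y ∈ (extChartAt (𝓡 2) x).source) (v w : TangentSpace (𝓡 2) y) :
    wedge (φ y) (ψ y) v w =
      chartWedge φ ψ x (extChartAt (𝓡 2) x y) (chartDiff x y v) (chartDiff x y w) := by
  unfold wedge chartWedge
  rw [form_apply_eq_chartForm φ hy, form_apply_eq_chartForm φ hy, form_apply_eq_chartForm ψ hy,
    form_apply_eq_chartForm ψ hy]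

section Coframing

variable {θ₁ θ₂ : OneForm (𝓡 2) M} {D : Set M}

theorem chartWedge_ne_zero (hθ : IsCoframing θ₁ θ₂ D) {x : M} (hx : x ∈ D) :
    chartWedge θ₁ θ₂ x (extChartAt (𝓡 2) x x) (planeBasis 0) (planeBasis 1) ≠ 0 := by
  have h := hθ.ne x hx
  rw [wedge_eq_chartWedge θ₁ θ₂ (mem_extChartAt_source x), isAreaMultiple_chartWedge] at h
  exact left_ne_zero_of_mul h

theorem contMDiffAt_ratio_wedge (hθ : IsCoframing θ₁ θ₂ D) {x : M} (hx : x ∈ D)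
    {φ ψ : OneForm (𝓡 2) M} (hφ : SmoothFormAt φ x) (hψ : SmoothFormAt ψ x) :
    ContMDiffAt (𝓡 2) 𝓘(ℝ, ℝ) ∞ (fun y => ratio θ₁ θ₂ y (wedge (φ y) (ψ y))) x := by
  refine (contMDiffAt_comp_extChartAt ((contDiffAt_chartWedge hφ hψ (planeBasis 0)
    (planeBasis 1)).div (contDiffAt_chartWedge (hθ.smooth₁ x hx) (hθ.smooth₂ x hx) (planeBasis 0)
    (planeBasis 1)) (chartWedge_ne_zero hθ hx))).congr_of_eventuallyEq ?_
  filter_upwards [hθ.eventually_mem hx] with y hy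
  exact ratio_eq_div (isAreaMultiple_chartWedge φ ψ x _) (isAreaMultiple_chartWedge θ₁ θ₂ x _)
    (wedge_eq_chartWedge φ ψ hy.2) (wedge_eq_chartWedge θ₁ θ₂ hy.2) (hθ.ne y hy.1)

theorem contMDiffAt_ratio_extD (hθ : IsCoframing θ₁ θ₂ D) {x : M} (hx : x ∈ D)
    {φ : OneForm (𝓡 2) M} (hφ : SmoothFormAt φ x) :
    ContMDiffAt (𝓡 2) 𝓘(ℝ, ℝ) ∞ (fun y => ratio θ₁ θ₂ y (extD φ y)) x := by
  have hd : ContDiffAt ℝ ∞ (fun u => extDeriv (chartForm φ x) u ![planeBasis 0, planeBasis 1])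
      (extChartAt (𝓡 2) x x) := by
    have h1 : ContDiffAt ℝ ∞ (fderiv ℝ (chartForm φ x)) (extChartAt (𝓡 2) x x) :=
      ContDiffAt.fderiv_right hφ (by norm_cast)
    have h2 : ∀ (a b : Plane), ContDiffAt ℝ ∞ (fun u => fderiv ℝ (chartForm φ x) u a ![b])
        (extChartAt (𝓡 2) x x) := fun a b =>
      (ContinuousAlternatingMap.apply ℝ Plane ℝ ![b]).contDiff.contDiffAt.comp _
        (h1.clm_apply contDiffAt_const)
    refine ((h2 (planeBasis 0) (planeBasis 1)).sub (h2 (planeBasis 1)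
      (planeBasis 0))).congr_of_eventuallyEq (Filter.Eventually.of_forall fun u => ?_)
    exact extDeriv_apply_pair _ _ _ _
  have hone : (1 : WithTop ℕ∞) ≤ ∞ := by norm_cast
  have hev : ∀ᶠ y in 𝓝 x, DifferentiableAt ℝ (chartForm φ x) (extChartAt (𝓡 2) x y) :=
    (continuousAt_extChartAt (I := 𝓡 2) x).eventually
      (((ContDiffAt.of_le hφ hone).eventually (by simp)).mono
        fun u hu => hu.differentiableAt (by simp))
  refine (contMDiffAt_comp_extChartAt (hd.div (contDiffAt_chartWedge (hθ.smooth₁ x hx)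
    (hθ.smooth₂ x hx) (planeBasis 0) (planeBasis 1))
    (chartWedge_ne_zero hθ hx))).congr_of_eventuallyEq ?_
  filter_upwards [hθ.eventually_mem hx, hev] with y hy hy'
  exact ratio_eq_div (isAreaMultiple_alternating _) (isAreaMultiple_chartWedge θ₁ θ₂ x _)
    (extD_eq_extDeriv_chartForm hy.2 hy') (wedge_eq_chartWedge θ₁ θ₂ hy.2) (hθ.ne y hy.1)

/-- Turns df into an ordinary Fréchet derivative at all coordinate points near the centre, as the
planar curve argument and the local constancy argument require. -/
theorem eventually_hasFDerivAt_coordForm {f : M → ℝ} {x : M}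
    (hf : ∀ᶠ y in 𝓝 x, MDifferentiableAt (𝓡 2) 𝓘(ℝ, ℝ) f y) :
    ∀ᶠ u in 𝓝 (extChartAt (𝓡 2) x x), HasFDerivAt (f ∘ (extChartAt (𝓡 2) x).symm)
      (coordForm (mvfderiv (𝓡 2) f) x u) u := by
  filter_upwards [(tendsto_extChartAt_symm (I := 𝓡 2) x).eventually hf,
    (isOpen_extChartAt_target (I := 𝓡 2) x).mem_nhds (mem_extChartAt_target x)] with u hu hu'
  have hs := ((contMDiffOn_extChartAt_symm (n := ∞) x).contMDiffAt
    ((isOpen_extChartAt_target x).mem_nhds hu')).mdifferentiableAt (I := 𝓘(ℝ, Plane))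
      (I' := 𝓡 2) (by simp)
  have hc : mfderiv 𝓘(ℝ, Plane) 𝓘(ℝ, ℝ) (f ∘ (extChartAt (𝓡 2) x).symm) u =
      (mfderiv (𝓡 2) 𝓘(ℝ, ℝ) f ((extChartAt (𝓡 2) x).symm u)).comp
        (mfderiv 𝓘(ℝ, Plane) (𝓡 2) (extChartAt (𝓡 2) x).symm u) :=
    mfderiv_comp u hu hs
  rw [mfderiv_eq_fderiv] at hc
  have hd : DifferentiableAt ℝ (f ∘ (extChartAt (𝓡 2) x).symm) u :=
    (hu.comp u hs).differentiableAt
  have : coordForm (mvfderiv (𝓡 2) f) x u = fderiv ℝ (f ∘ (extChartAt (𝓡 2) x).symm) u := hc.symm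
  rw [this]
  exact hd.hasFDerivAt

theorem eventually_mdifferentiableAt {f : M → ℝ} {x : M}
    (hf : ContMDiffAt (𝓡 2) 𝓘(ℝ, ℝ) ∞ f x) :
    ∀ᶠ y in 𝓝 x, MDifferentiableAt (𝓡 2) 𝓘(ℝ, ℝ) f y := by
  have hone : (1 : WithTop ℕ∞) ≤ ∞ := by norm_cast
  exact (contMDiffAt_iff_contMDiffAt_nhds (by simp) |>.1 (hf.of_le hone)).mono fun y hy =>
    hy.mdifferentiableAt (by simp)

theorem smoothFormAt_mvfderiv {f : M → ℝ} {x : M} (hf : ContMDiffAt (𝓡 2) 𝓘(ℝ, ℝ) ∞ f x) :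
    SmoothFormAt (mvfderiv (𝓡 2) f) x := by
  have h1 : ContDiffAt ℝ ∞ (f ∘ (extChartAt (𝓡 2) x).symm) (extChartAt (𝓡 2) x x) := by
    refine contMDiffAt_iff_contDiffAt.1 (ContMDiffAt.comp _ (I' := 𝓡 2) ?_
      ((contMDiffOn_extChartAt_symm x).contMDiffAt
        ((isOpen_extChartAt_target x).mem_nhds (mem_extChartAt_target x))))
    rwa [extChartAt_to_inv]
  have h3 : ContDiffAt ℝ ∞ (fderiv ℝ (f ∘ (extChartAt (𝓡 2) x).symm)) (extChartAt (𝓡 2) x x) :=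
    h1.fderiv_right (by norm_cast)
  refine smoothFormAt_iff_coordForm.2 (h3.congr_of_eventuallyEq ?_)
  filter_upwards [eventually_hasFDerivAt_coordForm (eventually_mdifferentiableAt hf)] with u hu
  exact hu.fderiv.symm

theorem contMDiffAt_curv₁ (hθ : IsCoframing θ₁ θ₂ D) {x : M} (hx : x ∈ D) :
    ContMDiffAt (𝓡 2) 𝓘(ℝ, ℝ) ∞ (curv₁ θ₁ θ₂) x :=
  contMDiffAt_ratio_extD hθ hx (hθ.smooth₁ x hx)

theorem contMDiffAt_curv₂ (hθ : IsCoframing θ₁ θ₂ D) {x : M} (hx : x ∈ D) :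
    ContMDiffAt (𝓡 2) 𝓘(ℝ, ℝ) ∞ (curv₂ θ₁ θ₂) x :=
  (contMDiffAt_ratio_extD hθ hx (hθ.smooth₂ x hx)).neg

theorem contMDiffAt_coeff₁ (hθ : IsCoframing θ₁ θ₂ D) {x : M} (hx : x ∈ D) {f : M → ℝ}
    (hf : ContMDiffAt (𝓡 2) 𝓘(ℝ, ℝ) ∞ f x) :
    ContMDiffAt (𝓡 2) 𝓘(ℝ, ℝ) ∞ (coeff₁ θ₁ θ₂ f) x :=
  contMDiffAt_ratio_wedge hθ hx (smoothFormAt_mvfderiv hf) (hθ.smooth₂ x hx)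

theorem contMDiffAt_coeff₂ (hθ : IsCoframing θ₁ θ₂ D) {x : M} (hx : x ∈ D) {f : M → ℝ}
    (hf : ContMDiffAt (𝓡 2) 𝓘(ℝ, ℝ) ∞ f x) :
    ContMDiffAt (𝓡 2) 𝓘(ℝ, ℝ) ∞ (coeff₂ θ₁ θ₂ f) x :=
  contMDiffAt_ratio_wedge hθ hx (hθ.smooth₁ x hx) (smoothFormAt_mvfderiv hf)

theorem extD_theta₁_eq (hθ : IsCoframing θ₁ θ₂ D) {x : M} (hx : x ∈ D)
    (v w : TangentSpace (𝓡 2) x) :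
    extD θ₁ x v w = curv₁ θ₁ θ₂ x * wedge (θ₁ x) (θ₂ x) v w :=
  eq_ratio_mul_wedge hθ hx (isAreaMultiple_extD θ₁ x) v w

theorem extD_theta₂_eq (hθ : IsCoframing θ₁ θ₂ D) {x : M} (hx : x ∈ D)
    (v w : TangentSpace (𝓡 2) x) :
    extD θ₂ x v w = curv₂ θ₁ θ₂ x * wedge (θ₂ x) (θ₁ x) v w := by
  rw [wedge_swap (θ₁ x) (θ₂ x), curv₂, neg_mul_neg]
  exact eq_ratio_mul_wedge hθ hx (isAreaMultiple_extD θ₂ x) v w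

/-- The identity `d(df) = 0` in terms of the coframing. -/
theorem coeff_comm (hθ : IsCoframing θ₁ θ₂ D) {f : M → ℝ}
    (hf : ∀ x ∈ D, ContMDiffAt (𝓡 2) 𝓘(ℝ, ℝ) ∞ f x) {x : M} (hx : x ∈ D) :
    coeff₁ θ₁ θ₂ (coeff₂ θ₁ θ₂ f) x - coeff₂ θ₁ θ₂ (coeff₁ θ₁ θ₂ f) x
      + coeff₁ θ₁ θ₂ f x * curv₁ θ₁ θ₂ x - coeff₂ θ₁ θ₂ f x * curv₂ θ₁ θ₂ x = 0 := by
  set v : TangentSpace (𝓡 2) x := tangentBasis x 0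
  set w : TangentSpace (𝓡 2) x := tangentBasis x 1
  have h0 := (extD_mvfderiv (hf x hx)).2 v w
  have hev : ∀ᶠ y in 𝓝 x, mvfderiv (𝓡 2) f y =
      coeff₁ θ₁ θ₂ f y • θ₁ y + coeff₂ θ₁ θ₂ f y • θ₂ y := by
    filter_upwards [hθ.isOpen.mem_nhds hx] with y hy
    exact mvfderiv_eq_coeff hθ hy f
  have hd1 : MDifferentiableAt (𝓡 2) 𝓘(ℝ, ℝ) (coeff₁ θ₁ θ₂ f) x :=
    (contMDiffAt_coeff₁ hθ hx (hf x hx)).mdifferentiableAt (by simp)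
  have hd2 : MDifferentiableAt (𝓡 2) 𝓘(ℝ, ℝ) (coeff₂ θ₁ θ₂ f) x :=
    (contMDiffAt_coeff₂ hθ hx (hf x hx)).mdifferentiableAt (by simp)
  have hs1 := (hθ.smooth₁ x hx).formDiffAt
  have hs2 := (hθ.smooth₂ x hx).formDiffAt
  -- Expand d(f₁θ₁ + f₂θ₂) by Leibniz and the structure equations; the claim is its θ₁ ∧ θ₂
  -- coefficient.
  rw [extD_congr hev, extD_add (hs1.smul hd1) (hs2.smul hd2), extD_smul hd1 hs1,
    extD_smul hd2 hs2, extD_theta₁_eq hθ hx, extD_theta₂_eq hθ hx] at h0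
  have e : ∀ (g : M → ℝ) u, mvfderiv (𝓡 2) g x u =
      coeff₁ θ₁ θ₂ g x * θ₁ x u + coeff₂ θ₁ θ₂ g x * θ₂ x u :=
    fun g => DFunLike.congr_fun (mvfderiv_eq_coeff hθ hx g)
  have hne : wedge (θ₁ x) (θ₂ x) v w ≠ 0 := hθ.ne x hx
  refine (mul_eq_zero.1 ?_).resolve_right hne
  rw [← h0]
  unfold wedge
  rw [e, e, e, e]
  ring

end Coframing

end SurfaceCoframing

/-! ### Two transverse families of curves, and functions whose zero sets are invariant along them.
-/

section WebLemma

section Web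

/-- A solution of a scalar differential equation with slopes at most `1/4` through a given point of
a square exists over the whole side of the square. -/
theorem exists_solution_graph {F : ℝ × ℝ → ℝ} {r : ℝ} (hr : 0 < r) {K : NNReal}
    (hlip : LipschitzOnWith K F (Icc (-r) r ×ˢ Icc (-r) r))
    (hF : ∀ q ∈ Icc (-r) r ×ˢ Icc (-r) r, |F q| ≤ 1 / 4) {y : ℝ × ℝ}
    (hy1 : |y.1| ≤ r / 4) (hy2 : |y.2| ≤ r / 4) :
    ∃ g : ℝ → ℝ, g y.1 = y.2 ∧ (∀ s ∈ Icc (-r) r, g s ∈ Icc (-r) r) ∧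
      ∀ s ∈ Icc (-r) r, HasDerivWithinAt g (F (s, g s)) (Icc (-r) r) s := by
  have hlip' : ∀ t ∈ Icc (-r) r, LipschitzOnWith K (fun x => F (t, x)) (Icc (-r) r) := by
    intro t ht
    have hm : LipschitzWith 1 (fun x : ℝ => (t, x)) :=
      LipschitzWith.of_dist_le_mul fun a b => by simp [Prod.dist_eq]
    have := hlip.comp (hm.lipschitzOnWith (s := Icc (-r) r)) fun x hx => ⟨ht, hx⟩
    simpa [Function.comp_def] using this
  obtain ⟨R, hR⟩ : ∃ R : NNReal, (R : ℝ) = r := ⟨r.toNNReal, Real.coe_toNNReal r hr.le⟩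
  have hball : Metric.closedBall (0 : ℝ) (R : ℝ) = Icc (-r) r := by
    simp [Real.closedBall_eq_Icc, hR]
  have hy1' := abs_le.1 hy1
  have hy1m : y.1 ∈ Icc (-r) r := ⟨by linarith, by linarith⟩
  -- The time elapsed from `y.1` is at most 5r/4 and the slope at most 1/4, so a solution moves by
  -- at most 5r/16, less than the margin r - r/4 left by the starting height.
  have hpl : IsPicardLindelof (fun t x => F (t, x)) (tmin := -r) (tmax := r)
      ⟨y.1, hy1m⟩ 0 R (R / 4) (1 / 4) K := by
    refine ⟨?_, ?_, ?_, ?_⟩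
    · rw [hball]
      exact hlip'
    · rw [hball]
      exact fun x hx => hlip.continuousOn.comp
        (continuous_id.prodMk continuous_const).continuousOn fun t ht => ⟨ht, hx⟩
    · rw [hball]
      intro t ht x hx
      simpa using hF (t, x) ⟨ht, hx⟩
    · have : max (r - y.1) (y.1 - -r) ≤ 5 / 4 * r := max_le (by linarith) (by linarith)
      push_cast
      rw [hR]
      linarith
  obtain ⟨α, hα⟩ := ODE.FunSpace.exists_isFixedPt_next hpl (x := y.2)
    (by simpa [Real.norm_eq_abs, hR] using hy2)
  have hmem : ∀ t, α.compProj t ∈ Metric.closedBall (0 : ℝ) (R : ℝ) := fun t =>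
    α.compProj_mem_closedBall hpl.mul_max_le
  refine ⟨α.compProj, ?_, fun s _ => hball.subset (hmem s), fun t ht => ?_⟩
  · have := ODE.FunSpace.compProj_val (α := α) (t := ⟨y.1, hy1m⟩)
    rw [← hα, ODE.FunSpace.next_apply₀] at this
    rwa [← hα]
  · refine (ODE.hasDerivWithinAt_picard_Icc hy1m hpl.continuousOn_uncurry α.continuous_compProj.continuousOn (fun t' _ => hmem t') y.2
      ht).congr_of_mem ?_ ht
    intro t' ht'
    nth_rw 1 [← hα]
    rw [ODE.FunSpace.compProj_of_mem ht', ODE.FunSpace.next_apply]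

/-- By uniqueness for the linear equation w' = c w with bounded c, a solution that vanishes once is
the zero solution. Applied along a curve, this is the invariance of a zero set. -/
theorem ne_zero_of_hasDerivWithinAt {w c : ℝ → ℝ} {a b C t₀ : ℝ} (hc : ∀ t ∈ Icc a b, |c t| ≤ C)
    (hw : ∀ t ∈ Icc a b, HasDerivWithinAt w (c t * w t) (Icc a b) t) (ht₀ : t₀ ∈ Icc a b)
    (h0 : w t₀ ≠ 0) : ∀ t ∈ Icc a b, w t ≠ 0 := by
  intro t ht hwt
  have hlip : ∀ s ∈ Icc a b, LipschitzOnWith C.toNNReal (fun x => c s * x) univ := by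
    intro s hs
    refine LipschitzOnWith.of_dist_le_mul fun x _ x' _ => ?_
    rw [Real.dist_eq, ← mul_sub, abs_mul, Real.dist_eq]
    exact mul_le_mul_of_nonneg_right ((hc s hs).trans (Real.le_coe_toNNReal C)) (abs_nonneg _)
  have hcont : ContinuousOn w (Icc a b) := fun s hs => (hw s hs).continuousWithinAt
  refine h0 ?_
  rcases le_total t t₀ with h | h
  · have hsub : Icc t t₀ ⊆ Icc a b := Icc_subset_Icc ht.1 ht₀.2
    exact ODE_solution_unique_of_mem_Icc_right (v := fun s x => c s * x) (s := fun _ => univ)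
      (g := fun _ => 0) (fun s hs => hlip s (hsub (Ico_subset_Icc_self hs))) (hcont.mono hsub)
      (fun s hs => (hw s (hsub (Ico_subset_Icc_self hs))).mono_of_mem_nhdsWithin
        (Icc_mem_nhdsGE_of_mem ⟨ht.1.trans hs.1, hs.2.trans_le ht₀.2⟩)) (fun _ _ => mem_univ _)
      continuousOn_const (fun s _ => by simpa using hasDerivWithinAt_const s (Ici s) (0 : ℝ))
      (fun _ _ => mem_univ _) hwt (right_mem_Icc.2 h)
  · have hsub : Icc t₀ t ⊆ Icc a b := Icc_subset_Icc ht₀.1 ht.2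
    exact ODE_solution_unique_of_mem_Icc_left (v := fun s x => c s * x) (s := fun _ => univ)
      (g := fun _ => 0) (fun s hs => hlip s (hsub (Ioc_subset_Icc_self hs))) (hcont.mono hsub)
      (fun s hs => (hw s (hsub (Ioc_subset_Icc_self hs))).mono_of_mem_nhdsWithin
        (Icc_mem_nhdsLE_of_mem ⟨ht₀.1.trans_lt hs.1, hs.2.trans ht.2⟩)) (fun _ _ => mem_univ _)
      continuousOn_const (fun s _ => by simpa using hasDerivWithinAt_const s (Iic s) (0 : ℝ))
      (fun _ _ => mem_univ _) hwt (left_mem_Icc.2 h)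

/-- Two functions with vanishing product, whose zero sets are respectively invariant along the
nearly horizontal direction field `(1, F)` and the nearly vertical direction field `(G, 1)`: one of
them vanishes identically. -/
theorem eventually_eq_zero_of_web {F G u v cu cv : ℝ × ℝ → ℝ} {u' v' : ℝ × ℝ → ℝ × ℝ →L[ℝ] ℝ}
    {C : ℝ} (hF : ContDiffAt ℝ 1 F 0) (hG : ContDiffAt ℝ 1 G 0) (hF0 : F 0 = 0) (hG0 : G 0 = 0)
    (hu : ∀ᶠ q in 𝓝 (0 : ℝ × ℝ), HasFDerivAt u (u' q) q ∧ u' q (1, F q) = cu q * u q ∧ |cu q| ≤ C)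
    (hv : ∀ᶠ q in 𝓝 (0 : ℝ × ℝ), HasFDerivAt v (v' q) q ∧ v' q (G q, 1) = cv q * v q ∧ |cv q| ≤ C)
    (huv : ∀ᶠ q in 𝓝 (0 : ℝ × ℝ), u q * v q = 0) :
    (∀ᶠ q in 𝓝 (0 : ℝ × ℝ), u q = 0) ∨ ∀ᶠ q in 𝓝 (0 : ℝ × ℝ), v q = 0 := by
  obtain ⟨KF, sF, hsF, hKF⟩ := hF.exists_lipschitzOnWith
  obtain ⟨KG, sG, hsG, hKG⟩ := hG.exists_lipschitzOnWith
  have hFs : ∀ᶠ q in 𝓝 (0 : ℝ × ℝ), |F q| < 1 / 4 :=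
    (hF.continuousAt.abs).eventually_lt continuousAt_const (by simp [hF0])
  have hGs : ∀ᶠ q in 𝓝 (0 : ℝ × ℝ), |G q| < 1 / 4 :=
    (hG.continuousAt.abs).eventually_lt continuousAt_const (by simp [hG0])
  have hall : ∀ᶠ q in 𝓝 (0 : ℝ × ℝ), q ∈ sF ∧ q ∈ sG ∧ |F q| < 1 / 4 ∧ |G q| < 1 / 4 ∧
      (HasFDerivAt u (u' q) q ∧ u' q (1, F q) = cu q * u q ∧ |cu q| ≤ C) ∧
      (HasFDerivAt v (v' q) q ∧ v' q (G q, 1) = cv q * v q ∧ |cv q| ≤ C) ∧ u q * v q = 0 := by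
    filter_upwards [hsF, hsG, hFs, hGs, hu, hv, huv] with q h1 h2 h3 h4 h5 h6 h7
    exact ⟨h1, h2, h3, h4, h5, h6, h7⟩
  obtain ⟨r, hr, hball⟩ := Metric.nhds_basis_closedBall.eventually_iff.1 hall
  have hsq : ∀ q : ℝ × ℝ, q.1 ∈ Icc (-r) r → q.2 ∈ Icc (-r) r →
      q ∈ Metric.closedBall (0 : ℝ × ℝ) r := by
    intro q h1 h2
    rw [mem_closedBall_zero_iff, Prod.norm_def]
    exact max_le (abs_le.2 h1) (abs_le.2 h2)
  by_contra hcon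
  push Not at hcon
  have hq : ∀ᶠ q in 𝓝 (0 : ℝ × ℝ), |q.1| ≤ r / 4 ∧ |q.2| ≤ r / 4 := by
    filter_upwards [Metric.closedBall_mem_nhds (0 : ℝ × ℝ) (by positivity : 0 < r / 4)] with q hq
    rw [mem_closedBall_zero_iff, Prod.norm_def] at hq
    exact ⟨(le_max_left _ _).trans hq, (le_max_right _ _).trans hq⟩
  -- Points arbitrarily near 0 with u ≠ 0 and with v ≠ 0; the curves through them are graphs over
  -- the two sides of the square. The second family uses swapped coordinates.
  obtain ⟨y, hy0, hy1, hy2⟩ := (hcon.1.and_eventually hq).exists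
  obtain ⟨z, hz0, hz1, hz2⟩ := (hcon.2.and_eventually hq).exists
  obtain ⟨g, hg0, hg1, hg2⟩ := exists_solution_graph (F := F) hr
    (hKF.mono fun q hq => (hball (hsq q hq.1 hq.2)).1)
    (fun q hq => (hball (hsq q hq.1 hq.2)).2.2.1.le) hy1 hy2
  obtain ⟨h, hh0, hh1, hh2⟩ := exists_solution_graph (F := fun q => G q.swap) (y := z.swap)
    (K := KG) hr
    (by
      have hsw : LipschitzWith 1 (Prod.swap : ℝ × ℝ → ℝ × ℝ) :=
        LipschitzWith.of_dist_le_mul fun a b => by simp [Prod.dist_eq, max_comm]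
      have := hKG.comp (hsw.lipschitzOnWith (s := Icc (-r) r ×ˢ Icc (-r) r))
        (fun q hq => (hball (hsq q.swap hq.2 hq.1)).2.1)
      simpa [Function.comp_def] using this)
    (fun q hq => (hball (hsq q.swap hq.2 hq.1)).2.2.2.1.le) hz2 hz1
  have hu_ne : ∀ s ∈ Icc (-r) r, u (s, g s) ≠ 0 := by
    refine ne_zero_of_hasDerivWithinAt (w := fun s => u (s, g s)) (c := fun s => cu (s, g s))
      (C := C) (t₀ := y.1) ?_ ?_ ?_ ?_
    · exact fun s hs => (hball (hsq (s, g s) hs (hg1 s hs))).2.2.2.2.1.2.2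
    · intro s hs
      obtain ⟨d1, d2, -⟩ := (hball (hsq (s, g s) hs (hg1 s hs))).2.2.2.2.1
      rw [← d2]
      exact d1.comp_hasDerivWithinAt s ((hasDerivWithinAt_id s _).prodMk (hg2 s hs))
    · exact abs_le.1 (hy1.trans (by linarith))
    · rwa [hg0]
  have hv_ne : ∀ t ∈ Icc (-r) r, v (h t, t) ≠ 0 := by
    refine ne_zero_of_hasDerivWithinAt (w := fun t => v (h t, t)) (c := fun t => cv (h t, t))
      (C := C) (t₀ := z.2) ?_ ?_ ?_ ?_
    · exact fun s hs => (hball (hsq (h s, s) (hh1 s hs) hs)).2.2.2.2.2.1.2.2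
    · intro s hs
      obtain ⟨d1, d2, -⟩ := (hball (hsq (h s, s) (hh1 s hs) hs)).2.2.2.2.2.1
      rw [← d2]
      exact HasFDerivAt.comp_hasDerivWithinAt (f := fun t => (h t, t)) s d1
        ((hh2 s hs).prodMk (hasDerivWithinAt_id s _))
    · exact abs_le.1 (hz2.trans (by linarith))
    · have : h z.2 = z.1 := hh0
      rwa [this]
  have hgc : ContinuousOn g (Icc (-r) r) := fun s hs => (hg2 s hs).continuousWithinAt
  have hhc : ContinuousOn h (Icc (-r) r) := fun s hs => (hh2 s hs).continuousWithinAt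
  -- The graphs t = g s and s = h t cross at a fixed point of h ∘ g, which exists since this map
  -- sends the interval continuously into itself.
  have hcomp : ContinuousOn (fun s => h (g s)) (Icc (-r) r) := hhc.comp hgc hg1
  obtain ⟨s, hs, hfix⟩ : ∃ s ∈ Icc (-r) r, h (g s) = s :=
    exists_mem_Icc_isFixedPt_of_mapsTo hcomp (by linarith) fun s hs => hh1 _ (hg1 s hs)
  have h1 := hu_ne s hs
  have h2 := hv_ne (g s) (hg1 s hs)
  rw [hfix] at h2
  exact mul_ne_zero h1 h2 (hball (hsq (s, g s) hs (hg1 s hs))).2.2.2.2.2.2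

/-- The version of `eventually_eq_zero_of_web` for a coframing `(φ₁, φ₂)` of the plane, given
near `p`. -/
theorem eventually_eq_zero_of_coframing {φ₁ φ₂ : Plane → Plane →L[ℝ] ℝ} {p : Plane}
    (h₁ : ContDiffAt ℝ 1 φ₁ p) (h₂ : ContDiffAt ℝ 1 φ₂ p)
    (hne : φ₁ p (planeBasis 0) * φ₂ p (planeBasis 1)
      - φ₁ p (planeBasis 1) * φ₂ p (planeBasis 0) ≠ 0)
    {u v c₁ c₂ e₁ e₂ : Plane → ℝ} {C : ℝ}
    (hu : ∀ᶠ q in 𝓝 p, HasFDerivAt u ((c₁ q * u q) • φ₁ q + e₁ q • φ₂ q) q ∧ |c₁ q| ≤ C)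
    (hv : ∀ᶠ q in 𝓝 p, HasFDerivAt v (e₂ q • φ₁ q + (c₂ q * v q) • φ₂ q) q ∧ |c₂ q| ≤ C)
    (huv : ∀ᶠ q in 𝓝 p, u q * v q = 0) :
    (∀ᶠ q in 𝓝 p, u q = 0) ∨ ∀ᶠ q in 𝓝 p, v q = 0 := by
  have hinj : Function.Injective ((φ₁ p).prod (φ₂ p)).toLinearMap := by
    rw [injective_iff_map_eq_zero]
    intro w hw
    have hw1 : φ₁ p w = 0 := congrArg Prod.fst hw
    have hw2 : φ₂ p w = 0 := congrArg Prod.snd hw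
    rw [plane_eq_sum w] at hw1 hw2
    simp only [map_add, map_smul, smul_eq_mul] at hw1 hw2
    have e0 : w 0 = 0 := (mul_eq_zero.1 (show w 0 * (φ₁ p (planeBasis 0) * φ₂ p (planeBasis 1)
      - φ₁ p (planeBasis 1) * φ₂ p (planeBasis 0)) = 0 by
        linear_combination φ₂ p (planeBasis 1) * hw1 - φ₁ p (planeBasis 1) * hw2)).resolve_right hne
    have e1 : w 1 = 0 := (mul_eq_zero.1 (show w 1 * (φ₁ p (planeBasis 0) * φ₂ p (planeBasis 1)
      - φ₁ p (planeBasis 1) * φ₂ p (planeBasis 0)) = 0 by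
        linear_combination φ₁ p (planeBasis 0) * hw2 - φ₂ p (planeBasis 0) * hw1)).resolve_right hne
    rw [plane_eq_sum w, e0, e1]
    simp
  -- Linear coordinates in which the coframing at `p` is standard; `X`, `Y` below is the dual frame
  -- at `p`.
  let L : Plane ≃L[ℝ] ℝ × ℝ :=
    (LinearEquiv.ofInjectiveOfFinrankEq _ hinj (by simp)).toContinuousLinearEquiv
  have hL : ∀ w, L w = (φ₁ p w, φ₂ p w) := fun w => rfl
  set X : Plane := L.symm (1, 0) with hX
  set Y : Plane := L.symm (0, 1) with hY
  have hX1 : φ₁ p X = 1 := congrArg Prod.fst (L.apply_symm_apply (1, 0))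
  have hX2 : φ₂ p X = 0 := congrArg Prod.snd (L.apply_symm_apply (1, 0))
  have hY1 : φ₁ p Y = 0 := congrArg Prod.fst (L.apply_symm_apply (0, 1))
  have hY2 : φ₂ p Y = 1 := congrArg Prod.snd (L.apply_symm_apply (0, 1))
  have hLs : ∀ a b : ℝ, L.symm (a, b) = a • X + b • Y := by
    intro a b
    rw [hX, hY, ← map_smul, ← map_smul, ← map_add]
    simp
  set P : ℝ × ℝ → Plane := fun q => p + L.symm q with hP
  have hP0 : P 0 = p := by simp [hP]
  have hPd : ∀ q, HasFDerivAt P (L.symm : ℝ × ℝ →L[ℝ] Plane) q := fun q =>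
    (L.symm.hasFDerivAt).const_add p
  have hPc : ContDiff ℝ 1 P := contDiff_const.add L.symm.contDiff
  have hPt : Filter.Tendsto P (𝓝 0) (𝓝 p) := by
    have := hPc.continuous.tendsto 0
    rwa [hP0] at this
  have hd₁ : ∀ w, ContDiffAt ℝ 1 (fun q => φ₁ (P q) w) 0 := fun w =>
    (ContDiffAt.comp 0 (by rwa [hP0]) hPc.contDiffAt).clm_apply contDiffAt_const
  have hd₂ : ∀ w, ContDiffAt ℝ 1 (fun q => φ₂ (P q) w) 0 := fun w =>
    (ContDiffAt.comp 0 (by rwa [hP0]) hPc.contDiffAt).clm_apply contDiffAt_const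
  -- The slopes are chosen so that X + F Y spans the kernel of φ₂ and G X + Y that of φ₁. Both
  -- vanish at 0, and the unknown components `e₁`, `e₂` drop out along these directions.
  set F : ℝ × ℝ → ℝ := fun q => -(φ₂ (P q) X) / φ₂ (P q) Y with hF
  set G : ℝ × ℝ → ℝ := fun q => -(φ₁ (P q) Y) / φ₁ (P q) X with hG
  have hFc : ContDiffAt ℝ 1 F 0 := (hd₂ X).neg.div (hd₂ Y) (by simp [hP0, hY2])
  have hGc : ContDiffAt ℝ 1 G 0 := (hd₁ Y).neg.div (hd₁ X) (by simp [hP0, hX1])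
  have hF0 : F 0 = 0 := by simp [hF, hP0, hX2]
  have hG0 : G 0 = 0 := by simp [hG, hP0, hY1]
  have hne₁ : ∀ᶠ q in 𝓝 (0 : ℝ × ℝ), φ₁ (P q) X ≠ 0 :=
    (hd₁ X).continuousAt.eventually_ne (by simp [hP0, hX1])
  have hne₂ : ∀ᶠ q in 𝓝 (0 : ℝ × ℝ), φ₂ (P q) Y ≠ 0 :=
    (hd₂ Y).continuousAt.eventually_ne (by simp [hP0, hY2])
  have hb₁ : ∀ᶠ q in 𝓝 (0 : ℝ × ℝ), |φ₁ (P q) X + F q * φ₁ (P q) Y| < 2 :=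
    ((hd₁ X).continuousAt.add (hFc.continuousAt.mul (hd₁ Y).continuousAt)).abs.eventually_lt
      continuousAt_const (by simp [hP0, hX1, hF0])
  have hb₂ : ∀ᶠ q in 𝓝 (0 : ℝ × ℝ), |G q * φ₂ (P q) X + φ₂ (P q) Y| < 2 :=
    ((hGc.continuousAt.mul (hd₂ X).continuousAt).add (hd₂ Y).continuousAt).abs.eventually_lt
      continuousAt_const (by simp [hP0, hY2, hG0])
  have hback : Filter.Tendsto (fun q => L (q - p)) (𝓝 p) (𝓝 0) := by
    have : Continuous fun q => L (q - p) := by fun_prop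
    simpa using this.tendsto p
  have hPback : ∀ q, P (L (q - p)) = q := by simp [hP]
  have key := eventually_eq_zero_of_web (F := F) (G := G) (u := fun q => u (P q))
    (v := fun q => v (P q))
    (cu := fun q => c₁ (P q) * (φ₁ (P q) X + F q * φ₁ (P q) Y))
    (cv := fun q => c₂ (P q) * (G q * φ₂ (P q) X + φ₂ (P q) Y))
    (u' := fun q => ((c₁ (P q) * u (P q)) • φ₁ (P q) + e₁ (P q) • φ₂ (P q)).comp
      (L.symm : ℝ × ℝ →L[ℝ] Plane))
    (v' := fun q => (e₂ (P q) • φ₁ (P q) + (c₂ (P q) * v (P q)) • φ₂ (P q)).comp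
      (L.symm : ℝ × ℝ →L[ℝ] Plane))
    (C := C * 2) hFc hGc hF0 hG0
    (by
      filter_upwards [hPt.eventually hu, hne₂, hb₁] with q hq hq2 hq3
      refine ⟨hq.1.comp q (hPd q), ?_, ?_⟩
      · have e : φ₂ (P q) X + F q * φ₂ (P q) Y = 0 := by
          simp only [hF]
          field_simp
          ring
        simp only [ContinuousLinearMap.comp_apply, ContinuousLinearEquiv.coe_coe, hLs,
          add_apply, smul_apply, map_add, map_smul, smul_eq_mul]
        linear_combination e₁ (P q) * e
      · rw [abs_mul]
        exact mul_le_mul hq.2 hq3.le (abs_nonneg _) ((abs_nonneg _).trans hq.2))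
    (by
      filter_upwards [hPt.eventually hv, hne₁, hb₂] with q hq hq2 hq3
      refine ⟨hq.1.comp q (hPd q), ?_, ?_⟩
      · have e : G q * φ₁ (P q) X + φ₁ (P q) Y = 0 := by
          simp only [hG]
          field_simp
          ring
        simp only [ContinuousLinearMap.comp_apply, ContinuousLinearEquiv.coe_coe, hLs,
          add_apply, smul_apply, map_add, map_smul, smul_eq_mul]
        linear_combination e₂ (P q) * e
      · rw [abs_mul]
        exact mul_le_mul hq.2 hq3.le (abs_nonneg _) ((abs_nonneg _).trans hq.2))
    (hPt.eventually huv)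
  refine key.imp (fun h => ?_) fun h => ?_
  · filter_upwards [hback.eventually h] with q hq
    rwa [hPback] at hq
  · filter_upwards [hback.eventually h] with q hq
    rwa [hPback] at hq

end Web

section Surface

variable {M : Type*} [TopologicalSpace M] [ChartedSpace Plane M] [IsManifold (𝓡 2) ∞ M]
  {θ₁ θ₂ : OneForm (𝓡 2) M} {D : Set M}

/-- Let `f` and `g` be functions on a surface with `f g = 0`, such that the zero set of `f` is
invariant along the curves `θ₂ = 0` and the zero set of `g` along the curves `θ₁ = 0`. Then near
each point one of them vanishes. -/
theorem eventually_eq_zero_of_mul_eq_zero (hθ : IsCoframing θ₁ θ₂ D) {f g c₁ c₂ : M → ℝ} {x : M}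
    (hx : x ∈ D) (hf : ∀ y ∈ D, MDifferentiableAt (𝓡 2) 𝓘(ℝ, ℝ) f y)
    (hg : ∀ y ∈ D, MDifferentiableAt (𝓡 2) 𝓘(ℝ, ℝ) g y)
    (hc₁ : ContinuousAt c₁ x) (hc₂ : ContinuousAt c₂ x)
    (hf₁ : ∀ y ∈ D, coeff₁ θ₁ θ₂ f y = c₁ y * f y) (hg₂ : ∀ y ∈ D, coeff₂ θ₁ θ₂ g y = c₂ y * g y)
    (hfg : ∀ y ∈ D, f y * g y = 0) :
    (∀ᶠ y in 𝓝 x, f y = 0) ∨ ∀ᶠ y in 𝓝 x, g y = 0 := by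
  have hone : (1 : WithTop ℕ∞) ≤ ∞ := by norm_cast
  have hD : ∀ᶠ y in 𝓝 x, y ∈ D := hθ.isOpen.mem_nhds hx
  set s := (extChartAt (𝓡 2) x).symm with hs
  have ht : Filter.Tendsto s (𝓝 (extChartAt (𝓡 2) x x)) (𝓝 x) := tendsto_extChartAt_symm x
  have hcoord : ∀ (h : M → ℝ) (u : Plane), s u ∈ D →
      coordForm (mvfderiv (𝓡 2) h) x u =
        coeff₁ θ₁ θ₂ h (s u) • coordForm θ₁ x u + coeff₂ θ₁ θ₂ h (s u) • coordForm θ₂ x u := by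
    intro h u hu
    unfold coordForm
    rw [mvfderiv_eq_coeff hθ hu]
    rfl
  have hbound : ∀ᶠ y in 𝓝 x, |c₁ y| < max |c₁ x| |c₂ x| + 1 ∧ |c₂ y| < max |c₁ x| |c₂ x| + 1 :=
    (hc₁.abs.eventually_lt continuousAt_const ((le_max_left _ _).trans_lt (lt_add_one _))).and
      (hc₂.abs.eventually_lt continuousAt_const ((le_max_right _ _).trans_lt (lt_add_one _)))
  have key := eventually_eq_zero_of_coframing (p := extChartAt (𝓡 2) x x)
    (φ₁ := coordForm θ₁ x) (φ₂ := coordForm θ₂ x)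
    (u := f ∘ s) (v := g ∘ s) (c₁ := c₁ ∘ s) (c₂ := c₂ ∘ s) (e₁ := fun u => coeff₂ θ₁ θ₂ f (s u))
    (e₂ := fun u => coeff₁ θ₁ θ₂ g (s u)) (C := max |c₁ x| |c₂ x| + 1)
    ((smoothFormAt_iff_coordForm.1 (hθ.smooth₁ x hx)).of_le hone)
    ((smoothFormAt_iff_coordForm.1 (hθ.smooth₂ x hx)).of_le hone)
    (chartWedge_ne_zero hθ hx)
    (by
      filter_upwards [eventually_hasFDerivAt_coordForm (hD.mono hf), ht.eventually hD,
        ht.eventually hbound] with u h1 h2 h3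
      rw [hcoord f u h2, hf₁ _ h2] at h1
      exact ⟨h1, h3.1.le⟩)
    (by
      filter_upwards [eventually_hasFDerivAt_coordForm (hD.mono hg), ht.eventually hD,
        ht.eventually hbound] with u h1 h2 h3
      rw [hcoord g u h2, hg₂ _ h2] at h1
      exact ⟨h1, h3.2.le⟩)
    ((ht.eventually hD).mono fun u hu => hfg _ hu)
  have hsrc : ∀ᶠ y in 𝓝 x, s (extChartAt (𝓡 2) x y) = y := by
    filter_upwards [(isOpen_extChartAt_source (I := 𝓡 2) x).mem_nhds (mem_extChartAt_source x)]
      with y hy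
    exact (extChartAt (𝓡 2) x).left_inv hy
  refine key.imp (fun h => ?_) fun h => ?_
  · filter_upwards [(continuousAt_extChartAt (I := 𝓡 2) x).eventually h, hsrc] with y hy hy'
    rwa [Function.comp_apply, hy'] at hy
  · filter_upwards [(continuousAt_extChartAt (I := 𝓡 2) x).eventually h, hsrc] with y hy hy'
    rwa [Function.comp_apply, hy'] at hy

end Surface

end WebLemma

/-! ### The Frobenius condition on M × ℝ³ as the vanishing of an obstruction on M. -/

section FrobeniusObstruction

section HasDifferential

variable {E : Type*} [NormedAddCommGroup E] [NormedSpace ℝ E]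
  {H : Type*} [TopologicalSpace H] {I : ModelWithCorners ℝ E H}
  {N : Type*} [TopologicalSpace N] [ChartedSpace H N]

variable (I) in
/-- The function `f` is differentiable at `q`, with differential `α`. -/
def HasDifferential (f : N → ℝ) (q : N) (α : TangentSpace I q → ℝ) : Prop :=
  MDifferentiableAt I 𝓘(ℝ, ℝ) f q ∧ ∀ v, mvfderiv I f q v = α v

theorem _root_.MDifferentiableAt.hasDifferential {f : N → ℝ} {q : N}
    (h : MDifferentiableAt I 𝓘(ℝ, ℝ) f q) : HasDifferential I f q (mvfderiv I f q) :=
  ⟨h, fun _ => rfl⟩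

variable {f g : N → ℝ} {q : N} {α β : TangentSpace I q → ℝ}

theorem HasDifferential.congr_right (hf : HasDifferential I f q α) (h : ∀ v, α v = β v) :
    HasDifferential I f q β :=
  ⟨hf.1, fun v => (hf.2 v).trans (h v)⟩

theorem hasDifferential_const (c : ℝ) : HasDifferential I (fun _ : N => c) q fun _ => 0 :=
  ⟨mdifferentiableAt_const, fun v => by rw [mvfderiv_const]; rfl⟩

theorem HasDifferential.add (hf : HasDifferential I f q α) (hg : HasDifferential I g q β) :
    HasDifferential I (fun y => f y + g y) q fun v => α v + β v :=
  ⟨hf.1.add hg.1, fun v => by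
    rw [show (fun y => f y + g y) = f + g from rfl, mvfderiv_add hf.1 hg.1, ← funext hf.2,
      ← funext hg.2]
    rfl⟩

theorem HasDifferential.sub (hf : HasDifferential I f q α) (hg : HasDifferential I g q β) :
    HasDifferential I (fun y => f y - g y) q fun v => α v - β v :=
  ⟨hf.1.sub hg.1, fun v => by
    rw [show (fun y => f y - g y) = f - g from rfl, mvfderiv_sub hf.1 hg.1, ← funext hf.2,
      ← funext hg.2]
    rfl⟩

theorem HasDifferential.mul (hf : HasDifferential I f q α) (hg : HasDifferential I g q β) :
    HasDifferential I (fun y => f y * g y) q fun v => f q * β v + g q * α v :=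
  ⟨hf.1.mul hg.1, fun v => by
    rw [show (fun y => f y * g y) = f * g from rfl, mvfderiv_mul hf.1 hg.1, ← funext hf.2,
      ← funext hg.2]
    rfl⟩

end HasDifferential

variable {M : Type*} [TopologicalSpace M] [ChartedSpace Plane M]
  {θ₁ θ₂ : OneForm (𝓡 2) M} {D : Set M}

theorem contMDiff_fibre {ℓ : ℝ × ℝ × ℝ →L[ℝ] ℝ} :
    ContMDiff abpModel 𝓘(ℝ, ℝ) ∞ (fun q : M × (ℝ × ℝ × ℝ) => ℓ q.2) :=
  ContMDiff.comp (I' := 𝓘(ℝ, ℝ × ℝ × ℝ)) ℓ.contDiff.contMDiff contMDiff_snd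

/-- The projection of a tangent vector of `M × ℝ³` to `M`. -/
def baseVec (q : M × (ℝ × ℝ × ℝ)) (v : TangentSpace abpModel q) : TangentSpace (𝓡 2) q.1 :=
  mfderiv abpModel (𝓡 2) Prod.fst q v

theorem lift_apply (θ : OneForm (𝓡 2) M) (q : M × (ℝ × ℝ × ℝ)) (v : TangentSpace abpModel q) :
    lift θ q v = θ q.1 (baseVec q v) := rfl

theorem hasDifferential_fibre (ℓ : ℝ × ℝ × ℝ →L[ℝ] ℝ) (q : M × (ℝ × ℝ × ℝ)) :
    HasDifferential abpModel (fun q : M × (ℝ × ℝ × ℝ) => ℓ q.2) q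
      fun v => ℓ ((show Plane × (ℝ × ℝ × ℝ) from v).2) := by
  have hs : MDifferentiableAt abpModel 𝓘(ℝ, ℝ × ℝ × ℝ)
      (Prod.snd : M × (ℝ × ℝ × ℝ) → ℝ × ℝ × ℝ) q := mdifferentiableAt_snd
  have hl : MDifferentiableAt 𝓘(ℝ, ℝ × ℝ × ℝ) 𝓘(ℝ, ℝ) ℓ q.2 :=
    ℓ.differentiableAt.mdifferentiableAt
  refine ⟨contMDiff_fibre.mdifferentiableAt (by simp), fun v => ?_⟩
  have h := mfderiv_comp q hl hs
  rw [mfderiv_snd, mfderiv_eq_fderiv, ContinuousLinearMap.fderiv] at h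
  exact DFunLike.congr_fun h v

theorem HasDifferential.comp_fst {f : M → ℝ} {q : M × (ℝ × ℝ × ℝ)}
    {α : TangentSpace (𝓡 2) q.1 → ℝ} (hf : HasDifferential (𝓡 2) f q.1 α) :
    HasDifferential abpModel (fun q : M × (ℝ × ℝ × ℝ) => f q.1) q fun v => α (baseVec q v) := by
  have hs : MDifferentiableAt abpModel (𝓡 2)
      (Prod.fst : M × (ℝ × ℝ × ℝ) → M) q := mdifferentiableAt_fst
  refine ⟨hf.1.comp q hs, fun v => ?_⟩
  rw [← funext hf.2]
  exact DFunLike.congr_fun (mfderiv_comp q hf.1 hs) v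

theorem hasDifferential_coeff (hθ : IsCoframing θ₁ θ₂ D) {x : M} (hx : x ∈ D) {f : M → ℝ}
    (hf : ContMDiffAt (𝓡 2) 𝓘(ℝ, ℝ) ∞ f x) :
    HasDifferential (𝓡 2) f x
      fun v => coeff₁ θ₁ θ₂ f x * θ₁ x v + coeff₂ θ₁ θ₂ f x * θ₂ x v :=
  ⟨hf.mdifferentiableAt (by simp), DFunLike.congr_fun (mvfderiv_eq_coeff hθ hx f)⟩

variable [IsManifold (𝓡 2) ∞ M]

/-- Naturality of d for the projection to `M`: the structure equations persist on the product. -/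
theorem extD_lift {θ : OneForm (𝓡 2) M} {q : M × (ℝ × ℝ × ℝ)} (hθ : FormDiffAt θ q.1) :
    FormDiffAt (lift θ) q ∧
      ∀ v w, extD (lift θ) q v w = extD θ q.1 (baseVec q v) (baseVec q w) :=
  extD_pullback (I := abpModel) (I' := 𝓡 2) (F := Prod.fst) (φ := θ) (x := q) (y := q.1)
    (mem_extChartAt_source _) contMDiffAt_fst hθ

/-- The exterior derivative of a Pfaffian form `df - (P θ₁ + Q θ₂)` on `M × ℝ³`. -/
theorem extD_pfaffian (hθ : IsCoframing θ₁ θ₂ D) {f P Q : M × (ℝ × ℝ × ℝ) → ℝ}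
    {q : M × (ℝ × ℝ × ℝ)} (hq : q.1 ∈ D) (hf : ContMDiffAt abpModel 𝓘(ℝ, ℝ) ∞ f q)
    {P' Q' : TangentSpace abpModel q → ℝ} (hP : HasDifferential abpModel P q P')
    (hQ : HasDifferential abpModel Q q Q') (v w : TangentSpace abpModel q) :
    extD (fun q => mvfderiv abpModel f q - (P q • lift θ₁ q + Q q • lift θ₂ q)) q v w =
      -(P' v * lift θ₁ q w - P' w * lift θ₁ q v + (Q' v * lift θ₂ q w - Q' w * lift θ₂ q v)
        + (P q * curv₁ θ₁ θ₂ q.1 - Q q * curv₂ θ₁ θ₂ q.1) *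
          (lift θ₁ q v * lift θ₂ q w - lift θ₁ q w * lift θ₂ q v)) := by
  obtain ⟨d0, h0⟩ := extD_mvfderiv hf
  obtain ⟨d1, h1⟩ := extD_lift (hθ.smooth₁ _ hq).formDiffAt
  obtain ⟨d2, h2⟩ := extD_lift (hθ.smooth₂ _ hq).formDiffAt
  rw [extD_sub d0 ((d1.smul hP.1).add (d2.smul hQ.1)), h0, extD_add (d1.smul hP.1) (d2.smul hQ.1),
    extD_smul hP.1 d1, extD_smul hQ.1 d2, h1, h2, extD_theta₁_eq hθ hq, extD_theta₂_eq hθ hq]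
  simp only [wedge, hP.2, hQ.2, lift_apply]
  ring

/-- The coefficient `K₁ - K₂ + K₁ K₂ - K₁₁` of the `(a, b, p)` system. -/
def abpAlpha (θ₁ θ₂ : OneForm (𝓡 2) M) (x : M) : ℝ :=
  curv₁ θ₁ θ₂ x - curv₂ θ₁ θ₂ x + curv₁ θ₁ θ₂ x * curv₂ θ₁ θ₂ x - coeff₁ θ₁ θ₂ (curv₁ θ₁ θ₂) x

/-- The coefficient `K₁ - K₂ - K₁ K₂ + K₂₂` of the `(a, b, p)` system. -/
def abpBeta (θ₁ θ₂ : OneForm (𝓡 2) M) (x : M) : ℝ :=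
  curv₁ θ₁ θ₂ x - curv₂ θ₁ θ₂ x - curv₁ θ₁ θ₂ x * curv₂ θ₁ θ₂ x + coeff₂ θ₁ θ₂ (curv₂ θ₁ θ₂) x

/-- The obstruction to integrability of the `(a, b, p)` system. -/
def abpObstruction (θ₁ θ₂ : OneForm (𝓡 2) M) (x : M) (a b p : ℝ) : ℝ :=
  (p - 1) * (coeff₂ θ₁ θ₂ (curv₂ θ₁ θ₂) x + 4 - 2 * curv₂ θ₁ θ₂ x + 2 * abpBeta θ₁ θ₂ x)
    + (p + 1) * (-coeff₁ θ₁ θ₂ (curv₁ θ₁ θ₂) x - 4 + 2 * curv₁ θ₁ θ₂ x + 2 * abpAlpha θ₁ θ₂ x)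
    + 2 * a * coeff₁ θ₁ θ₂ (abpAlpha θ₁ θ₂) x - 2 * b * coeff₂ θ₁ θ₂ (abpBeta θ₁ θ₂) x

theorem contMDiffAt_abpAlpha (hθ : IsCoframing θ₁ θ₂ D) {x : M} (hx : x ∈ D) :
    ContMDiffAt (𝓡 2) 𝓘(ℝ, ℝ) ∞ (abpAlpha θ₁ θ₂) x :=
  (((contMDiffAt_curv₁ hθ hx).sub (contMDiffAt_curv₂ hθ hx)).add
    ((contMDiffAt_curv₁ hθ hx).mul (contMDiffAt_curv₂ hθ hx))).sub
      (contMDiffAt_coeff₁ hθ hx (contMDiffAt_curv₁ hθ hx))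

theorem contMDiffAt_abpBeta (hθ : IsCoframing θ₁ θ₂ D) {x : M} (hx : x ∈ D) :
    ContMDiffAt (𝓡 2) 𝓘(ℝ, ℝ) ∞ (abpBeta θ₁ θ₂) x :=
  (((contMDiffAt_curv₁ hθ hx).sub (contMDiffAt_curv₂ hθ hx)).sub
    ((contMDiffAt_curv₁ hθ hx).mul (contMDiffAt_curv₂ hθ hx))).add
      (contMDiffAt_coeff₂ hθ hx (contMDiffAt_curv₂ hθ hx))

/-- The exterior derivatives of the three forms of the `(a, b, p)` system on its kernel. -/
theorem extD_abpSystem (hθ : IsCoframing θ₁ θ₂ D) {q : M × (ℝ × ℝ × ℝ)} (hq : q.1 ∈ D)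
    {v w : TangentSpace abpModel q} (hv : ∀ j, abpSystem θ₁ θ₂ j q v = 0)
    (hw : ∀ j, abpSystem θ₁ θ₂ j q w = 0) :
    extD (abpSystem θ₁ θ₂ 0) q v w = 0 ∧ extD (abpSystem θ₁ θ₂ 1) q v w = 0 ∧
      extD (abpSystem θ₁ θ₂ 2) q v w = -(abpObstruction θ₁ θ₂ q.1 q.2.1 q.2.2.1 q.2.2.2 *
        (lift θ₁ q v * lift θ₂ q w - lift θ₁ q w * lift θ₂ q v)) := by
  have sa : ContMDiffAt abpModel 𝓘(ℝ, ℝ) ∞ (fun q : M × (ℝ × ℝ × ℝ) => q.2.1) q :=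
    contMDiff_fibre (ℓ := ContinuousLinearMap.fst ℝ ℝ (ℝ × ℝ)) q
  have sb : ContMDiffAt abpModel 𝓘(ℝ, ℝ) ∞ (fun q : M × (ℝ × ℝ × ℝ) => q.2.2.1) q :=
    contMDiff_fibre (ℓ := (ContinuousLinearMap.fst ℝ ℝ ℝ).comp
      (ContinuousLinearMap.snd ℝ ℝ (ℝ × ℝ))) q
  have sp : ContMDiffAt abpModel 𝓘(ℝ, ℝ) ∞ (fun q : M × (ℝ × ℝ × ℝ) => q.2.2.2) q :=
    contMDiff_fibre (ℓ := (ContinuousLinearMap.snd ℝ ℝ ℝ).comp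
      (ContinuousLinearMap.snd ℝ ℝ (ℝ × ℝ))) q
  have ha := (sa.mdifferentiableAt (by simp)).hasDifferential
  have hb := (sb.mdifferentiableAt (by simp)).hasDifferential
  have hp := (sp.mdifferentiableAt (by simp)).hasDifferential
  have k1 := (hasDifferential_coeff hθ hq (contMDiffAt_curv₁ hθ hq)).comp_fst (q := q)
  have k2 := (hasDifferential_coeff hθ hq (contMDiffAt_curv₂ hθ hq)).comp_fst (q := q)
  have kα := (hasDifferential_coeff hθ hq (contMDiffAt_abpAlpha hθ hq)).comp_fst (q := q)
  have kβ := (hasDifferential_coeff hθ hq (contMDiffAt_abpBeta hθ hq)).comp_fst (q := q)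
  have c := fun r : ℝ => hasDifferential_const (I := abpModel) (q := q) r
  -- On the common kernel, da, db and dp may be replaced by the right-hand sides of the system.
  have da : ∀ u, abpSystem θ₁ θ₂ 0 q u = 0 → mvfderiv abpModel
      (fun q : M × (ℝ × ℝ × ℝ) => q.2.1) q u =
      (2 * q.2.1 + q.2.2.2 + 1) * lift θ₁ q u
        + (2 * q.2.1 * (1 - curv₁ θ₁ θ₂ q.1)) * lift θ₂ q u := fun u hu => sub_eq_zero.1 hu
  have db : ∀ u, abpSystem θ₁ θ₂ 1 q u = 0 → mvfderiv abpModel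
      (fun q : M × (ℝ × ℝ × ℝ) => q.2.2.1) q u =
      (2 * q.2.2.1 * (1 - curv₂ θ₁ θ₂ q.1)) * lift θ₁ q u
        + (2 * q.2.2.1 - q.2.2.2 + 1) * lift θ₂ q u := fun u hu => sub_eq_zero.1 hu
  have dp : ∀ u, abpSystem θ₁ θ₂ 2 q u = 0 → mvfderiv abpModel
      (fun q : M × (ℝ × ℝ × ℝ) => q.2.2.2) q u =
      ((2 - curv₂ θ₁ θ₂ q.1) * (q.2.2.2 - 1) + 2 * abpBeta θ₁ θ₂ q.1 * q.2.2.1) * lift θ₁ q u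
        + ((2 - curv₁ θ₁ θ₂ q.1) * (q.2.2.2 + 1) + 2 * abpAlpha θ₁ θ₂ q.1 * q.2.1) * lift θ₂ q u :=
    fun u hu => sub_eq_zero.1 hu
  have P0 := (((c 2).mul ha).add hp).add (c 1)
  have Q0 := ((c 2).mul ha).mul ((c 1).sub k1)
  have P1 := ((c 2).mul hb).mul ((c 1).sub k2)
  have Q1 := (((c 2).mul hb).sub hp).add (c 1)
  have P2 := (((c 2).sub k2).mul (hp.sub (c 1))).add (((c 2).mul kβ).mul hb)
  have Q2 := (((c 2).sub k1).mul (hp.add (c 1))).add (((c 2).mul kα).mul ha)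
  refine ⟨(extD_pfaffian hθ hq sa P0 Q0 v w).trans ?_,
    (extD_pfaffian hθ hq sb P1 Q1 v w).trans ?_, (extD_pfaffian hθ hq sp P2 Q2 v w).trans ?_⟩
  -- The K₁₁ in α, entering through dp, cancels the one produced by differentiating 1 - K₁; in the
  -- next form K₂₂ in β cancels likewise.
  · simp only [← lift_apply, da v (hv 0), da w (hw 0), dp v (hv 2), dp w (hw 2), abpAlpha, abpBeta]
    ring
  · simp only [← lift_apply, db v (hv 1), db w (hw 1), dp v (hv 2), dp w (hw 2), abpAlpha, abpBeta]
    ring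
  · simp only [← lift_apply, da v (hv 0), da w (hw 0), db v (hv 1), db w (hw 1), dp v (hv 2),
      dp w (hw 2), abpObstruction]
    ring

/-- The kernel of the system projects onto the tangent plane of `M`, so θ₁ ∧ θ₂ is nonzero on it and
the coefficient must vanish over every (a, b, p). -/
theorem abpFrobeniusOn_iff (hθ : IsCoframing θ₁ θ₂ D) :
    AbpFrobeniusOn θ₁ θ₂ D ↔ ∀ x ∈ D, ∀ a b p : ℝ, abpObstruction θ₁ θ₂ x a b p = 0 := by
  constructor
  · intro h x hx a b p
    set q : M × (ℝ × ℝ × ℝ) := (x, a, b, p) with hq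
    have hlift : ∀ V : TangentSpace (𝓡 2) x, ∃ v : TangentSpace abpModel q,
        (∀ j, abpSystem θ₁ θ₂ j q v = 0) ∧ lift θ₁ q v = θ₁ x V ∧ lift θ₂ q v = θ₂ x V := by
      intro V
      have hbase : ∀ y : ℝ × ℝ × ℝ, baseVec q (show TangentSpace abpModel q from (V, y)) = V := by
        intro y
        unfold baseVec
        rw [mfderiv_fst]
        rfl
      have hfib := fun (ℓ : ℝ × ℝ × ℝ →L[ℝ] ℝ) (y : ℝ × ℝ × ℝ) =>
        (hasDifferential_fibre ℓ q).2 (show TangentSpace abpModel q from (V, y))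
      -- The fibre component of the lift of `V` is dictated by the right-hand sides of the system.
      set y : ℝ × ℝ × ℝ :=
        ((2 * a + p + 1) * θ₁ x V + (2 * a * (1 - curv₁ θ₁ θ₂ x)) * θ₂ x V,
          (2 * b * (1 - curv₂ θ₁ θ₂ x)) * θ₁ x V + (2 * b - p + 1) * θ₂ x V,
          ((2 - curv₂ θ₁ θ₂ x) * (p - 1) + 2 * abpBeta θ₁ θ₂ x * b) * θ₁ x V
            + ((2 - curv₁ θ₁ θ₂ x) * (p + 1) + 2 * abpAlpha θ₁ θ₂ x * a) * θ₂ x V) with hy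
      have l1 : lift θ₁ q (show TangentSpace abpModel q from (V, y)) = θ₁ x V :=
        congrArg (θ₁ x) (hbase y)
      have l2 : lift θ₂ q (show TangentSpace abpModel q from (V, y)) = θ₂ x V :=
        congrArg (θ₂ x) (hbase y)
      refine ⟨(show TangentSpace abpModel q from (V, y)), fun j => ?_, l1, l2⟩
      fin_cases j
      · refine sub_eq_zero.2 ((hfib (ContinuousLinearMap.fst ℝ ℝ (ℝ × ℝ)) y).trans ?_)
        rw [← l1, ← l2] at hy
        exact congrArg Prod.fst hy
      · refine sub_eq_zero.2 ((hfib ((ContinuousLinearMap.fst ℝ ℝ ℝ).comp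
          (ContinuousLinearMap.snd ℝ ℝ (ℝ × ℝ))) y).trans ?_)
        rw [← l1, ← l2] at hy
        exact congrArg (fun y => y.2.1) hy
      · refine sub_eq_zero.2 ((hfib ((ContinuousLinearMap.snd ℝ ℝ ℝ).comp
          (ContinuousLinearMap.snd ℝ ℝ (ℝ × ℝ))) y).trans ?_)
        rw [← l1, ← l2] at hy
        exact congrArg (fun y => y.2.2) hy
    obtain ⟨v, hv, hv1, hv2⟩ := hlift (tangentBasis x 0)
    obtain ⟨w, hw, hw1, hw2⟩ := hlift (tangentBasis x 1)
    have h1 := (extD_abpSystem hθ (q := q) hx hv hw).2.2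
    rw [h q hx v w hv hw 2, hv1, hv2, hw1, hw2] at h1
    exact (mul_eq_zero.1 (neg_eq_zero.1 h1.symm)).resolve_right (hθ.ne x hx)
  · intro h q hq v w hv hw i
    obtain ⟨h0, h1, h2⟩ := extD_abpSystem hθ hq hv hw
    rw [h q.1 hq, zero_mul, neg_zero] at h2
    fin_cases i
    exacts [h0, h1, h2]

end FrobeniusObstruction

/-! ### The forms θ₁, θ₂ of a nondegenerate invertible operator are a coframing. -/

section Theta

section Nonvanishing

/-- Eigenvectors for distinct eigenvalues span the plane. -/
theorem covector_eq_zero_of_eigenvectors {T : Plane →L[ℝ] Plane} {a b : ℝ} (hab : a ≠ b)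
    {v w : Plane} (hv : T v = a • v) (hw : T w = b • w) (hv0 : v ≠ 0) (hw0 : w ≠ 0)
    {α : Plane →L[ℝ] ℝ} (hαv : α v = 0) (hαw : α w = 0) : α = 0 := by
  have hli : LinearIndependent ℝ ![v, w] := by
    rw [LinearIndependent.pair_iff]
    intro s t h
    have h1 : T (s • v + t • w) = 0 := by rw [h, map_zero]
    rw [map_add, map_smul, map_smul, hv, hw] at h1
    have h2 : (s * (a - b)) • v = 0 := by
      have : (s * (a - b)) • v = (s • a • v + t • b • w) - b • (s • v + t • w) := by module
      rw [this, h1, h, smul_zero, sub_zero]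
    have hs : s = 0 := (mul_eq_zero.1 ((smul_eq_zero.1 h2).resolve_right hv0)).resolve_right
      (sub_ne_zero.2 hab)
    rw [hs, zero_smul, zero_add] at h
    exact ⟨hs, (smul_eq_zero.1 h).resolve_right hw0⟩
  have hspan := hli.span_eq_top_of_card_eq_finrank (by simp)
  have : α.toLinearMap = 0 := by
    refine LinearMap.ext_on_range hspan fun i => ?_
    fin_cases i
    · exact hαv
    · exact hαw
  exact ContinuousLinearMap.coe_injective this

end Nonvanishing

variable {M : Type*} [TopologicalSpace M] [ChartedSpace Plane M]

/-- `d'` and `d''` of functions in the chart at `x`. -/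
theorem coordForm_dPrime {S : EndoField M} {A B f : M → ℝ} (x : M) (u w : Plane) :
    coordForm (dPrime S A B f) x u w =
      (A ((extChartAt (𝓡 2) x).symm u) - B ((extChartAt (𝓡 2) x).symm u))⁻¹ *
      (mvfderiv (𝓡 2) f ((extChartAt (𝓡 2) x).symm u) (S ((extChartAt (𝓡 2) x).symm u)
        (mfderiv 𝓘(ℝ, Plane) (𝓡 2) (extChartAt (𝓡 2) x).symm u w))
        - B ((extChartAt (𝓡 2) x).symm u) * coordForm (mvfderiv (𝓡 2) f) x u w) := by
  set z := (extChartAt (𝓡 2) x).symm u with hz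
  set V : TangentSpace (𝓡 2) z := mfderiv 𝓘(ℝ, Plane) (𝓡 2) (extChartAt (𝓡 2) x).symm u w with hV
  change mvfderiv (𝓡 2) f z ((A z - B z)⁻¹ • (S z V - B z • V)) = (A z - B z)⁻¹ *
    (mvfderiv (𝓡 2) f z (S z V) - B z * mvfderiv (𝓡 2) f z V)
  rw [map_smul, map_sub, map_smul]
  rfl

variable [IsManifold (𝓡 2) ∞ M] {S : EndoField M} {A B : M → ℝ} {D : Set M}

/-- Smoothness of a section of the endomorphism bundle means smoothness of its matrix in the
trivialization at `x`, and that trivialization is the derivative of the chart. -/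
theorem exists_smooth_endomorphism {x : M} (hS : ContMDiffAt (𝓡 2)
    ((𝓡 2).prod 𝓘(ℝ, Plane →L[ℝ] Plane)) ∞
    (fun x => (⟨x, S x⟩ : Bundle.TotalSpace (Plane →L[ℝ] Plane)
      (fun x : M => TangentSpace (𝓡 2) x →L[ℝ] TangentSpace (𝓡 2) x))) x) :
    ∃ T : Plane → Plane →L[ℝ] Plane, ContDiffAt ℝ ∞ T (extChartAt (𝓡 2) x x) ∧
      ∀ᶠ u in 𝓝 (extChartAt (𝓡 2) x x), ∀ w : Plane,
        S ((extChartAt (𝓡 2) x).symm u) (mfderiv 𝓘(ℝ, Plane) (𝓡 2) (extChartAt (𝓡 2) x).symm u w)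
          = mfderiv 𝓘(ℝ, Plane) (𝓡 2) (extChartAt (𝓡 2) x).symm u (T u w) := by
  have h := ((contMDiffAt_hom_bundle _).1 hS).2
  set s := (extChartAt (𝓡 2) x).symm with hs
  set T₀ : M → Plane →L[ℝ] Plane := fun y => ContinuousLinearMap.inCoordinates Plane
    (TangentSpace (𝓡 2)) Plane (TangentSpace (𝓡 2)) x y x y (S y) with hT₀
  refine ⟨T₀ ∘ s, ?_, ?_⟩
  · refine contMDiffAt_iff_contDiffAt.1 (ContMDiffAt.comp _ (I' := 𝓡 2) ?_
      ((contMDiffOn_extChartAt_symm x).contMDiffAt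
        ((isOpen_extChartAt_target x).mem_nhds (mem_extChartAt_target x))))
    rw [extChartAt_to_inv]
    exact h
  · filter_upwards [(isOpen_extChartAt_target (I := 𝓡 2) x).mem_nhds (mem_extChartAt_target x)]
      with u hu w
    have hsu : s u ∈ (chartAt Plane x).source := by
      rw [← extChartAt_source (I := 𝓡 2)]
      exact (extChartAt (𝓡 2) x).map_target hu
    have hcu : extChartAt (𝓡 2) x (s u) = u := (extChartAt (𝓡 2) x).right_inv hu
    have h1 := TangentBundle.continuousLinearMapAt_trivializationAt (I := 𝓡 2) hsu
    have h2 := TangentBundle.symmL_trivializationAt (I := 𝓡 2) hsu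
    have h3 := mfderivWithin_extChartAt_symm_comp_mfderiv_extChartAt (I := 𝓡 2) hu
    rw [(𝓡 2).range_eq_univ, mfderivWithin_univ] at h2 h3
    have h2' : (trivializationAt Plane (TangentSpace (𝓡 2)) x).symmL ℝ (s u) w =
        mfderiv 𝓘(ℝ, Plane) (𝓡 2) s u w := by
      rw [h2]
      exact congrArg (fun u' => (show Plane from mfderiv 𝓘(ℝ, Plane) (𝓡 2) s u' w)) hcu
    have h4 : (T₀ ∘ s) u w = mfderiv (𝓡 2) 𝓘(ℝ, Plane) (extChartAt (𝓡 2) x) (s u)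
        (S (s u) (mfderiv 𝓘(ℝ, Plane) (𝓡 2) s u w)) := by
      rw [← h1, ← h2']
      rfl
    rw [h4]
    exact (DFunLike.congr_fun h3 _).symm

theorem smoothFormAt_smul_dPrime {f c : M → ℝ} {x : M} (hS : ContMDiffAt (𝓡 2)
    ((𝓡 2).prod 𝓘(ℝ, Plane →L[ℝ] Plane)) ∞
    (fun x => (⟨x, S x⟩ : Bundle.TotalSpace (Plane →L[ℝ] Plane)
      (fun x : M => TangentSpace (𝓡 2) x →L[ℝ] TangentSpace (𝓡 2) x))) x)
    (hA : ContMDiffAt (𝓡 2) 𝓘(ℝ, ℝ) ∞ A x) (hB : ContMDiffAt (𝓡 2) 𝓘(ℝ, ℝ) ∞ B x)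
    (hf : ContMDiffAt (𝓡 2) 𝓘(ℝ, ℝ) ∞ f x) (hc : ContMDiffAt (𝓡 2) 𝓘(ℝ, ℝ) ∞ c x)
    (hAB : A x ≠ B x) :
    SmoothFormAt (fun y => c y • dPrime S A B f y) x := by
  obtain ⟨T, hT, hTS⟩ := exists_smooth_endomorphism hS
  set s := (extChartAt (𝓡 2) x).symm with hs
  have hcomp : ∀ {g : M → ℝ}, ContMDiffAt (𝓡 2) 𝓘(ℝ, ℝ) ∞ g x →
      ContDiffAt ℝ ∞ (fun u => g (s u)) (extChartAt (𝓡 2) x x) := fun {g} hg => by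
    refine contMDiffAt_iff_contDiffAt.1 (ContMDiffAt.comp _ (I' := 𝓡 2) ?_
      ((contMDiffOn_extChartAt_symm x).contMDiffAt
        ((isOpen_extChartAt_target x).mem_nhds (mem_extChartAt_target x))))
    rwa [extChartAt_to_inv]
  have hdf := smoothFormAt_iff_coordForm.1 (smoothFormAt_mvfderiv hf)
  have hne : A (s (extChartAt (𝓡 2) x x)) - B (s (extChartAt (𝓡 2) x x)) ≠ 0 := by
    rw [hs, extChartAt_to_inv]
    exact sub_ne_zero.2 hAB
  refine smoothFormAt_iff_coordForm.2 ((((hcomp hc).mul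
    (((hcomp hA).sub (hcomp hB)).inv hne)).smul ((hdf.clm_comp hT).sub
      ((hcomp hB).smul hdf))).congr_of_eventuallyEq ?_)
  filter_upwards [hTS] with u hu
  ext w
  have h1 : coordForm (fun y => c y • dPrime S A B f y) x u w =
      c (s u) * coordForm (dPrime S A B f) x u w := rfl
  rw [h1, coordForm_dPrime, hu w]
  change c (s u) * ((A (s u) - B (s u))⁻¹ * _) = (c (s u) * (A (s u) - B (s u))⁻¹) * _
  rw [mul_assoc]
  rfl

/-- The forms `θ₁` and `θ₂` are a coframing. -/
theorem isCoframing_theta (hD : IsOpen D) (hS : IsInvertibleNondegenerate S A B D) :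
    IsCoframing (theta₁ S A B) (theta₂ S A B) D where
  isOpen := hD
  smooth₁ := fun x hx => by
    have hn := hD.mem_nhds hx
    have hA := (hS.smooth_A x hx).contMDiffAt hn
    have hB := (hS.smooth_B x hx).contMDiffAt hn
    have hB0 := hS.B_ne x hx
    have hAB := hS.ne x hx
    exact smoothFormAt_smul_dPrime ((hS.smooth x hx).contMDiffAt hn) hA hB hB
      (hA.div₀ (hB.mul (hB.sub hA)) (mul_ne_zero hB0 (sub_ne_zero.2 hAB.symm))) hAB
  smooth₂ := fun x hx => by
    have hn := hD.mem_nhds hx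
    have hA := (hS.smooth_A x hx).contMDiffAt hn
    have hB := (hS.smooth_B x hx).contMDiffAt hn
    have hA0 := hS.A_ne x hx
    have hAB := hS.ne x hx
    -- By definition, d'' for (A, B) is d' for (B, A).
    exact smoothFormAt_smul_dPrime ((hS.smooth x hx).contMDiffAt hn) hB hA hA
      (hB.div₀ (hA.mul (hA.sub hB)) (mul_ne_zero hA0 (sub_ne_zero.2 hAB))) hAB.symm
  ne := fun x hx h0 => by
    obtain ⟨v, hv⟩ := (hS.eigen_A x hx).exists_hasEigenvector
    obtain ⟨w, hw⟩ := (hS.eigen_B x hx).exists_hasEigenvector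
    have hAB := hS.ne x hx
    have hA0 := hS.A_ne x hx
    have hB0 := hS.B_ne x hx
    have hSv : S x v = A x • v := hv.apply_eq_smul
    have hSw : S x w = B x • w := hw.apply_eq_smul
    have hv0 := hv.2
    have hw0 := hw.2
    have hkw : dPrime S A B B x w = 0 := by
      have : eigenProj S A B x w = 0 := by
        change (A x - B x)⁻¹ • (S x w - B x • w) = 0
        rw [hSw, sub_self, smul_zero]
      change mvfderiv (𝓡 2) B x (eigenProj S A B x w) = 0
      rw [this, map_zero]
    have hkv : dPrime₂ S A B A x v = 0 := by
      have : eigenProj S B A x v = 0 := by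
        change (B x - A x)⁻¹ • (S x v - A x • v) = 0
        rw [hSv, sub_self, smul_zero]
      change mvfderiv (𝓡 2) A x (eigenProj S B A x v) = 0
      rw [this, map_zero]
    -- On the eigenvectors, d'B kills `w` and d''A kills `v`, so only the product d'B(v) d''A(w)
    -- survives. If it were zero, one of the two covectors would vanish on both eigenvectors.
    have hz : wedge (theta₁ S A B x) (theta₂ S A B x) v w = 0 := by
      refine (isAreaMultiple_wedge_tangent (theta₁ S A B x) (theta₂ S A B x) v w).trans ?_
      exact mul_eq_zero_of_left h0 _
    have hz' : (A x / (B x * (B x - A x))) * dPrime S A B B x v *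
        ((B x / (A x * (A x - B x))) * dPrime₂ S A B A x w) -
        (A x / (B x * (B x - A x))) * dPrime S A B B x w *
        ((B x / (A x * (A x - B x))) * dPrime₂ S A B A x v) = 0 := hz
    rw [hkw, mul_zero, zero_mul, sub_zero] at hz'
    have hc1 : A x / (B x * (B x - A x)) ≠ 0 :=
      div_ne_zero hA0 (mul_ne_zero hB0 (sub_ne_zero.2 hAB.symm))
    have hc2 : B x / (A x * (A x - B x)) ≠ 0 :=
      div_ne_zero hB0 (mul_ne_zero hA0 (sub_ne_zero.2 hAB))
    rcases mul_eq_zero.1 hz' with h | h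
    · exact hS.dB_ne x hx (covector_eq_zero_of_eigenvectors (T := S x) hAB hSv hSw hv0 hw0
        ((mul_eq_zero.1 h).resolve_left hc1) hkw)
    · exact hS.dA_ne x hx (covector_eq_zero_of_eigenvectors (T := S x) hAB hSv hSw hv0 hw0
        hkv ((mul_eq_zero.1 h).resolve_left hc2))

end Theta

/-! ### Differential consequences of the Frobenius condition, and the three types. -/

section Classification

variable {M : Type*} [TopologicalSpace M] [ChartedSpace Plane M]
  {θ₁ θ₂ : OneForm (𝓡 2) M} {D : Set M}

theorem coeff_eq_of_hasDifferential (hθ : IsCoframing θ₁ θ₂ D) {x : M} (hx : x ∈ D) {f : M → ℝ}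
    {a b : ℝ} (h : HasDifferential (𝓡 2) f x fun v => a * θ₁ x v + b * θ₂ x v) :
    coeff₁ θ₁ θ₂ f x = a ∧ coeff₂ θ₁ θ₂ f x = b := by
  have e : mvfderiv (𝓡 2) f x = a • θ₁ x + b • θ₂ x := ContinuousLinearMap.ext h.2
  exact ⟨coeff₁_eq hθ hx e, coeff₂_eq hθ hx e⟩

theorem mvfderiv_congr {f g : M → ℝ} {x : M} (h : f =ᶠ[𝓝 x] g) :
    mvfderiv (𝓡 2) f x = mvfderiv (𝓡 2) g x := by
  ext v
  change mfderiv (𝓡 2) 𝓘(ℝ, ℝ) f x v = mfderiv (𝓡 2) 𝓘(ℝ, ℝ) g x v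
  rw [h.mfderiv_eq]
  rfl

theorem mvfderiv_congr_of_eqOn (hD : IsOpen D) {f g : M → ℝ} (h : EqOn f g D) {x : M}
    (hx : x ∈ D) : mvfderiv (𝓡 2) f x = mvfderiv (𝓡 2) g x :=
  mvfderiv_congr (h.eventuallyEq_of_mem (hD.mem_nhds hx))

theorem coeff_congr (hD : IsOpen D) {f g : M → ℝ} (h : EqOn f g D) {x : M} (hx : x ∈ D) :
    coeff₁ θ₁ θ₂ f x = coeff₁ θ₁ θ₂ g x ∧ coeff₂ θ₁ θ₂ f x = coeff₂ θ₁ θ₂ g x := by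
  unfold coeff₁ coeff₂
  rw [mvfderiv_congr_of_eqOn hD h hx]
  exact ⟨rfl, rfl⟩

theorem coeff_eq_zero_of_eqOn_const (hθ : IsCoframing θ₁ θ₂ D) {f : M → ℝ} {c : ℝ}
    (h : ∀ x ∈ D, f x = c) {x : M} (hx : x ∈ D) :
    coeff₁ θ₁ θ₂ f x = 0 ∧ coeff₂ θ₁ θ₂ f x = 0 := by
  have e := coeff_congr (θ₁ := θ₁) (θ₂ := θ₂) hθ.isOpen (f := f) (g := fun _ => c) h hx
  rw [e.1, e.2]
  exact coeff_eq_of_hasDifferential hθ hx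
    ((hasDifferential_const c).congr_right fun v => by ring)

/-- Leibniz with shifts built in, for the products of K₁ - 1, K₂ - 1, K₁ + 2, K₂ + 2. -/
theorem coeff_mul (hθ : IsCoframing θ₁ θ₂ D) {x : M} (hx : x ∈ D) {f g : M → ℝ}
    (hf : ContMDiffAt (𝓡 2) 𝓘(ℝ, ℝ) ∞ f x) (hg : ContMDiffAt (𝓡 2) 𝓘(ℝ, ℝ) ∞ g x) (r s : ℝ) :
    coeff₁ θ₁ θ₂ (fun y => (f y + r) * (g y + s)) x =
        (f x + r) * coeff₁ θ₁ θ₂ g x + (g x + s) * coeff₁ θ₁ θ₂ f x ∧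
      coeff₂ θ₁ θ₂ (fun y => (f y + r) * (g y + s)) x =
        (f x + r) * coeff₂ θ₁ θ₂ g x + (g x + s) * coeff₂ θ₁ θ₂ f x :=
  coeff_eq_of_hasDifferential hθ hx
    ((((hasDifferential_coeff hθ hx hf).add (hasDifferential_const r)).mul
      ((hasDifferential_coeff hθ hx hg).add (hasDifferential_const s))).congr_right
        fun v => by ring)

theorem coeff_affine (hθ : IsCoframing θ₁ θ₂ D) {x : M} (hx : x ∈ D) {f : M → ℝ}
    (hf : ContMDiffAt (𝓡 2) 𝓘(ℝ, ℝ) ∞ f x) (r s : ℝ) :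
    coeff₁ θ₁ θ₂ (fun y => r * f y + s) x = r * coeff₁ θ₁ θ₂ f x ∧
      coeff₂ θ₁ θ₂ (fun y => r * f y + s) x = r * coeff₂ θ₁ θ₂ f x :=
  coeff_eq_of_hasDifferential hθ hx
    ((((hasDifferential_const r).mul (hasDifferential_coeff hθ hx hf)).add
      (hasDifferential_const s)).congr_right fun v => by ring)

variable [IsManifold (𝓡 2) ∞ M]

/-- A function with vanishing differential on a connected open set is constant there. -/
theorem eq_of_mvfderiv_eq_zero (hD : IsOpen D) (hc : IsPreconnected D) {f : M → ℝ}
    (hf : ∀ x ∈ D, MDifferentiableAt (𝓡 2) 𝓘(ℝ, ℝ) f x)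
    (h0 : ∀ x ∈ D, mvfderiv (𝓡 2) f x = 0) {x y : M} (hx : x ∈ D) (hy : y ∈ D) : f x = f y := by
  have hloc : ∀ z ∈ D, ∀ᶠ z' in 𝓝 z, f z' = f z := by
    intro z hz
    have hDz : ∀ᶠ y in 𝓝 z, y ∈ D := hD.mem_nhds hz
    have h1 : ∀ᶠ u in 𝓝 (extChartAt (𝓡 2) z z),
        HasFDerivAt (f ∘ (extChartAt (𝓡 2) z).symm) (0 : Plane →L[ℝ] ℝ) u := by
      filter_upwards [eventually_hasFDerivAt_coordForm (hDz.mono hf),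
        (tendsto_extChartAt_symm (I := 𝓡 2) z).eventually hDz] with u hu hu'
      have : coordForm (mvfderiv (𝓡 2) f) z u = 0 := by
        unfold coordForm
        rw [h0 _ hu']
        rfl
      rwa [this] at hu
    obtain ⟨r, hr, hball⟩ := Metric.eventually_nhds_iff_ball.1 h1
    have h2 : ∀ u ∈ Metric.ball (extChartAt (𝓡 2) z z) r,
        (f ∘ (extChartAt (𝓡 2) z).symm) u = f z := by
      intro u hu
      have := (convex_ball (extChartAt (𝓡 2) z z) r).is_const_of_fderivWithin_eq_zero (𝕜 := ℝ)
        (fun w hw => (hball w hw).differentiableAt.differentiableWithinAt)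
        (fun w hw => by
          rw [fderivWithin_of_isOpen Metric.isOpen_ball hw, (hball w hw).fderiv])
        hu (Metric.mem_ball_self hr)
      rw [this, Function.comp_apply, extChartAt_to_inv]
    filter_upwards [(continuousAt_extChartAt (I := 𝓡 2) z).eventually
      (Metric.ball_mem_nhds _ hr),
      (isOpen_extChartAt_source (I := 𝓡 2) z).mem_nhds (mem_extChartAt_source z)] with z' h3 h4
    rw [← h2 _ h3, Function.comp_apply, (extChartAt (𝓡 2) z).left_inv h4]
  have : PreconnectedSpace D := Subtype.preconnectedSpace hc
  have hlc : IsLocallyConstant fun z : D => f z :=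
    (IsLocallyConstant.iff_eventually_eq _).2 fun z =>
      continuous_subtype_val.continuousAt.eventually (hloc z z.2)
  exact hlc.apply_eq_of_preconnectedSpace ⟨x, hx⟩ ⟨y, hy⟩

/-- Constancy of α and β removes the a and b terms of the obstruction; the other two hypotheses are
the coefficients of p - 1 and p + 1. -/
theorem abpFrobeniusOn_of_const (hθ : IsCoframing θ₁ θ₂ D) {r s : ℝ}
    (hα : ∀ x ∈ D, abpAlpha θ₁ θ₂ x = r) (hβ : ∀ x ∈ D, abpBeta θ₁ θ₂ x = s)
    (hX : ∀ x ∈ D, coeff₂ θ₁ θ₂ (curv₂ θ₁ θ₂) x + 4 - 2 * curv₂ θ₁ θ₂ x + 2 * s = 0)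
    (hY : ∀ x ∈ D, -coeff₁ θ₁ θ₂ (curv₁ θ₁ θ₂) x - 4 + 2 * curv₁ θ₁ θ₂ x + 2 * r = 0) :
    AbpFrobeniusOn θ₁ θ₂ D := by
  refine (abpFrobeniusOn_iff hθ).2 fun x hx a b p => ?_
  rw [abpObstruction, (coeff_eq_zero_of_eqOn_const hθ hα hx).1,
    (coeff_eq_zero_of_eqOn_const hθ hβ hx).2, hα x hx, hβ x hx, hX x hx, hY x hx]
  ring

theorem abpFrobeniusOn_of_typeI (hθ : IsCoframing θ₁ θ₂ D) (h : TypeIOn θ₁ θ₂ D) :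
    AbpFrobeniusOn θ₁ θ₂ D := by
  obtain ⟨k, k', h⟩ := h
  have h1 : ∀ x ∈ D, curv₁ θ₁ θ₂ x = 1 := fun x hx =>
    curv₁_eq hθ hx fun v w => by rw [(h x hx).1, one_mul]
  have h2 : EqOn (curv₂ θ₁ θ₂) k D := fun x hx => curv₂_eq hθ hx (h x hx).2.1
  have h11 : ∀ x ∈ D, coeff₁ θ₁ θ₂ (curv₁ θ₁ θ₂) x = 0 := fun x hx =>
    (coeff_eq_zero_of_eqOn_const hθ h1 hx).1
  have h22 : ∀ x ∈ D, coeff₂ θ₁ θ₂ (curv₂ θ₁ θ₂) x = 2 * (curv₂ θ₁ θ₂ x - 1) := fun x hx => by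
    rw [(coeff_congr hθ.isOpen h2 hx).2, coeff₂_eq hθ hx (h x hx).2.2, h2 hx]
  -- The constants come from α = 1 + J/3 and β = -1 - J/3 with J = (K₁ - 1)(K₂ - 1) = 0.
  refine abpFrobeniusOn_of_const hθ (r := 1) (s := -1) ?_ ?_ ?_ ?_ <;> intro x hx
  · rw [abpAlpha, h1 x hx, h11 x hx]; ring
  · rw [abpBeta, h1 x hx, h22 x hx]; ring
  · rw [h22 x hx]; ring
  · rw [h11 x hx, h1 x hx]; ring

theorem abpFrobeniusOn_of_typeIDual (hθ : IsCoframing θ₁ θ₂ D) (h : TypeIDualOn θ₁ θ₂ D) :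
    AbpFrobeniusOn θ₁ θ₂ D := by
  obtain ⟨k, k', h⟩ := h
  have h1 : EqOn (curv₁ θ₁ θ₂) k D := fun x hx => curv₁_eq hθ hx (h x hx).1
  have h2 : ∀ x ∈ D, curv₂ θ₁ θ₂ x = 1 := fun x hx =>
    curv₂_eq hθ hx fun v w => by rw [(h x hx).2.1, one_mul]
  have h11 : ∀ x ∈ D, coeff₁ θ₁ θ₂ (curv₁ θ₁ θ₂) x = 2 * (curv₁ θ₁ θ₂ x - 1) := fun x hx => by
    rw [(coeff_congr hθ.isOpen h1 hx).1, coeff₁_eq hθ hx (h x hx).2.2, h1 hx]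
  have h22 : ∀ x ∈ D, coeff₂ θ₁ θ₂ (curv₂ θ₁ θ₂) x = 0 := fun x hx =>
    (coeff_eq_zero_of_eqOn_const hθ h2 hx).2
  refine abpFrobeniusOn_of_const hθ (r := 1) (s := -1) ?_ ?_ ?_ ?_ <;> intro x hx
  · rw [abpAlpha, h2 x hx, h11 x hx]; ring
  · rw [abpBeta, h2 x hx, h22 x hx]; ring
  · rw [h22 x hx, h2 x hx]; ring
  · rw [h11 x hx]; ring

theorem abpFrobeniusOn_of_typeII (hθ : IsCoframing θ₁ θ₂ D) (h : TypeIIOn θ₁ θ₂ D) :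
    AbpFrobeniusOn θ₁ θ₂ D := by
  have h1 : ∀ x ∈ D, curv₁ θ₁ θ₂ x = -2 := fun x hx => curv₁_eq hθ hx (h x hx).1
  have h2 : ∀ x ∈ D, curv₂ θ₁ θ₂ x = -2 := fun x hx => curv₂_eq hθ hx (h x hx).2
  have h11 : ∀ x ∈ D, coeff₁ θ₁ θ₂ (curv₁ θ₁ θ₂) x = 0 := fun x hx =>
    (coeff_eq_zero_of_eqOn_const hθ h1 hx).1
  have h22 : ∀ x ∈ D, coeff₂ θ₁ θ₂ (curv₂ θ₁ θ₂) x = 0 := fun x hx =>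
    (coeff_eq_zero_of_eqOn_const hθ h2 hx).2
  -- Here J = 9, so 1 + J/3 = 4 and -1 - J/3 = -4.
  refine abpFrobeniusOn_of_const hθ (r := 4) (s := -4) ?_ ?_ ?_ ?_ <;> intro x hx
  · rw [abpAlpha, h1 x hx, h2 x hx, h11 x hx]; norm_num
  · rw [abpBeta, h1 x hx, h2 x hx, h22 x hx]; norm_num
  · rw [h22 x hx, h2 x hx]; norm_num
  · rw [h11 x hx, h1 x hx]; norm_num

/-- The conditions on the invariants `K₁` and `K₂` equivalent to the Frobenius condition. -/
structure HasFrobeniusInvariants (θ₁ θ₂ : OneForm (𝓡 2) M) (D : Set M) : Prop where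
  coeff₁₁ : ∀ x ∈ D, coeff₁ θ₁ θ₂ (curv₁ θ₁ θ₂) x =
    2 / 3 * ((curv₁ θ₁ θ₂ x - 1) * (curv₂ θ₁ θ₂ x + 2))
  coeff₂₂ : ∀ x ∈ D, coeff₂ θ₁ θ₂ (curv₂ θ₁ θ₂) x =
    2 / 3 * ((curv₂ θ₁ θ₂ x - 1) * (curv₁ θ₁ θ₂ x + 2))
  coeff₁_mul : ∀ x ∈ D,
    coeff₁ θ₁ θ₂ (fun y => (curv₁ θ₁ θ₂ y + -1) * (curv₂ θ₁ θ₂ y + -1)) x = 0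
  coeff₂_mul : ∀ x ∈ D,
    coeff₂ θ₁ θ₂ (fun y => (curv₁ θ₁ θ₂ y + -1) * (curv₂ θ₁ θ₂ y + -1)) x = 0

/-- The coefficients of the affine obstruction are isolated by evaluating it at (a, b, p) with a, b
in {0, 1} and p = ±1. -/
theorem hasFrobeniusInvariants (hθ : IsCoframing θ₁ θ₂ D) (h : AbpFrobeniusOn θ₁ θ₂ D) :
    HasFrobeniusInvariants θ₁ θ₂ D := by
  rw [abpFrobeniusOn_iff hθ] at h
  simp only [abpObstruction] at h
  have hX : ∀ x ∈ D, coeff₂ θ₁ θ₂ (curv₂ θ₁ θ₂) x + 4 - 2 * curv₂ θ₁ θ₂ x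
      + 2 * abpBeta θ₁ θ₂ x = 0 := fun x hx => by linarith [h x hx 0 0 (-1)]
  have hY : ∀ x ∈ D, -coeff₁ θ₁ θ₂ (curv₁ θ₁ θ₂) x - 4 + 2 * curv₁ θ₁ θ₂ x
      + 2 * abpAlpha θ₁ θ₂ x = 0 := fun x hx => by linarith [h x hx 0 0 1]
  have hα : ∀ x ∈ D, coeff₁ θ₁ θ₂ (abpAlpha θ₁ θ₂) x = 0 := fun x hx => by
    linarith [h x hx 0 0 1, h x hx 1 0 1]
  have hβ : ∀ x ∈ D, coeff₂ θ₁ θ₂ (abpBeta θ₁ θ₂) x = 0 := fun x hx => by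
    linarith [h x hx 0 0 1, h x hx 0 1 1]
  have h11 : ∀ x ∈ D, coeff₁ θ₁ θ₂ (curv₁ θ₁ θ₂) x =
      2 / 3 * ((curv₁ θ₁ θ₂ x - 1) * (curv₂ θ₁ θ₂ x + 2)) := fun x hx => by
    have := hY x hx
    rw [abpAlpha] at this
    linarith
  have h22 : ∀ x ∈ D, coeff₂ θ₁ θ₂ (curv₂ θ₁ θ₂) x =
      2 / 3 * ((curv₂ θ₁ θ₂ x - 1) * (curv₁ θ₁ θ₂ x + 2)) := fun x hx => by
    have := hX x hx
    rw [abpBeta] at this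
    linarith
  -- Once K₁₁ and K₂₂ are eliminated, α and β are both affine functions of the same product J, so α₁
  -- = 0 and β₂ = 0 give both components of dJ.
  have eα : EqOn (fun y => (curv₁ θ₁ θ₂ y + -1) * (curv₂ θ₁ θ₂ y + -1))
      (fun y => 3 * abpAlpha θ₁ θ₂ y + -3) D := fun x hx => by
    simp only [abpAlpha, h11 x hx]
    ring
  have eβ : EqOn (fun y => (curv₁ θ₁ θ₂ y + -1) * (curv₂ θ₁ θ₂ y + -1))
      (fun y => -3 * abpBeta θ₁ θ₂ y + -3) D := fun x hx => by
    simp only [abpBeta, h22 x hx]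
    ring
  refine ⟨h11, h22, fun x hx => ?_, fun x hx => ?_⟩
  · rw [(coeff_congr hθ.isOpen eα hx).1,
      (coeff_affine hθ hx (contMDiffAt_abpAlpha hθ hx) _ _).1, hα x hx, mul_zero]
  · rw [(coeff_congr hθ.isOpen eβ hx).2,
      (coeff_affine hθ hx (contMDiffAt_abpBeta hθ hx) _ _).2, hβ x hx, mul_zero]

theorem HasFrobeniusInvariants.typeII (hθ : IsCoframing θ₁ θ₂ D)
    (h : HasFrobeniusInvariants θ₁ θ₂ D)
    (hne : ∀ x ∈ D, (curv₁ θ₁ θ₂ x + -1) * (curv₂ θ₁ θ₂ x + -1) ≠ 0) : TypeIIOn θ₁ θ₂ D := by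
  have s1 := fun x hx => contMDiffAt_curv₁ hθ (x := x) hx
  have s2 := fun x hx => contMDiffAt_curv₂ hθ (x := x) hx
  -- Solve J₂ = 0 for K₁₂ by cancelling K₂ - 1 ≠ 0. The trailing `+ 0` gives the shape needed by
  -- `coeff_affine`.
  have h12 : EqOn (coeff₂ θ₁ θ₂ (curv₁ θ₁ θ₂))
      (fun y => -(2 / 3) * ((curv₁ θ₁ θ₂ y + -1) * (curv₁ θ₁ θ₂ y + 2)) + 0) D := fun x hx => by
    have e := h.coeff₂_mul x hx
    rw [(coeff_mul hθ hx (s1 x hx) (s2 x hx) (-1) (-1)).2, h.coeff₂₂ x hx] at e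
    refine mul_left_cancel₀ (right_ne_zero_of_mul (hne x hx)) ?_
    linear_combination e
  have h21 : ∀ x ∈ D, coeff₁ θ₁ θ₂ (curv₂ θ₁ θ₂) x =
      -(2 / 3) * ((curv₂ θ₁ θ₂ x + -1) * (curv₂ θ₁ θ₂ x + 2)) := fun x hx => by
    have e := h.coeff₁_mul x hx
    rw [(coeff_mul hθ hx (s1 x hx) (s2 x hx) (-1) (-1)).1, h.coeff₁₁ x hx] at e
    refine mul_left_cancel₀ (left_ne_zero_of_mul (hne x hx)) ?_
    linear_combination e
  have h11 : EqOn (coeff₁ θ₁ θ₂ (curv₁ θ₁ θ₂))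
      (fun y => 2 / 3 * ((curv₁ θ₁ θ₂ y + -1) * (curv₂ θ₁ θ₂ y + 2)) + 0) D := fun x hx => by
    simp only [h.coeff₁₁ x hx]
    ring
  -- All first derivatives of K₁ and K₂ are now polynomials in them, and d(dK₁) = 0 reduces to 4/9
  -- (K₁ - 1)(K₁ + 2)(K₂ + 2) = 0.
  have hzero : ∀ x ∈ D, (curv₁ θ₁ θ₂ x + 2) * (curv₂ θ₁ θ₂ x + 2) = 0 := fun x hx => by
    have e := coeff_comm hθ s1 hx
    have c1 : ContMDiffAt (𝓡 2) 𝓘(ℝ, ℝ) ∞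
        (fun y => (curv₁ θ₁ θ₂ y + -1) * (curv₁ θ₁ θ₂ y + 2)) x :=
      ((s1 x hx).add contMDiffAt_const).mul ((s1 x hx).add contMDiffAt_const)
    have c2 : ContMDiffAt (𝓡 2) 𝓘(ℝ, ℝ) ∞
        (fun y => (curv₁ θ₁ θ₂ y + -1) * (curv₂ θ₁ θ₂ y + 2)) x :=
      ((s1 x hx).add contMDiffAt_const).mul ((s2 x hx).add contMDiffAt_const)
    rw [(coeff_congr hθ.isOpen h12 hx).1, (coeff_congr hθ.isOpen h11 hx).2,
      (coeff_affine hθ hx c1 _ _).1, (coeff_affine hθ hx c2 _ _).2,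
      (coeff_mul hθ hx (s1 x hx) (s1 x hx) _ _).1, (coeff_mul hθ hx (s1 x hx) (s2 x hx) _ _).2,
      h12 hx, h.coeff₁₁ x hx, h.coeff₂₂ x hx] at e
    refine (mul_eq_zero.1 ?_).resolve_left (left_ne_zero_of_mul (hne x hx))
    linear_combination 9 / 4 * e
  -- Differentiate (K₁ + 2)(K₂ + 2) = 0 along θ₁: where K₁ = -2, this gives -2(K₂ + 2)² = 0. The
  -- other case uses θ₂.
  have hboth : ∀ x ∈ D, curv₁ θ₁ θ₂ x = -2 ∧ curv₂ θ₁ θ₂ x = -2 := fun x hx => by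
    obtain ⟨e1, e2⟩ := coeff_eq_zero_of_eqOn_const hθ hzero hx
    rw [(coeff_mul hθ hx (s1 x hx) (s2 x hx) _ _).1, h.coeff₁₁ x hx] at e1
    rw [(coeff_mul hθ hx (s1 x hx) (s2 x hx) _ _).2, h.coeff₂₂ x hx] at e2
    rcases mul_eq_zero.1 (hzero x hx) with hk | hk
    · have hk1 : curv₁ θ₁ θ₂ x = -2 := by linarith
      rw [hk1] at e1
      have : (curv₂ θ₁ θ₂ x + 2) ^ 2 = 0 := by linear_combination -1 / 2 * e1
      exact ⟨hk1, by linarith [pow_eq_zero_iff (two_ne_zero) |>.1 this]⟩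
    · have hk2 : curv₂ θ₁ θ₂ x = -2 := by linarith
      rw [hk2] at e2
      have : (curv₁ θ₁ θ₂ x + 2) ^ 2 = 0 := by linear_combination -1 / 2 * e2
      exact ⟨by linarith [pow_eq_zero_iff (two_ne_zero) |>.1 this], hk2⟩
  intro x hx
  obtain ⟨e1, e2⟩ := hboth x hx
  exact ⟨fun v w => by rw [extD_theta₁_eq hθ hx, e1], fun v w => by rw [extD_theta₂_eq hθ hx, e2]⟩

theorem HasFrobeniusInvariants.exists_typeI_union (hθ : IsCoframing θ₁ θ₂ D)
    (h : HasFrobeniusInvariants θ₁ θ₂ D)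
    (h0 : ∀ x ∈ D, (curv₁ θ₁ θ₂ x + -1) * (curv₂ θ₁ θ₂ x + -1) = 0) :
    ∃ D₁ D₂ : Set M, IsOpen D₁ ∧ IsOpen D₂ ∧ D = D₁ ∪ D₂ ∧
      TypeIOn θ₁ θ₂ D₁ ∧ TypeIDualOn θ₁ θ₂ D₂ := by
  have s1 := fun x hx => contMDiffAt_curv₁ hθ (x := x) hx
  have s2 := fun x hx => contMDiffAt_curv₂ hθ (x := x) hx
  -- The level sets themselves need not be open; that their interiors still cover D is the content
  -- of the crossing-curves lemma.
  refine ⟨interior {x | x ∈ D ∧ curv₁ θ₁ θ₂ x = 1}, interior {x | x ∈ D ∧ curv₂ θ₁ θ₂ x = 1},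
    isOpen_interior, isOpen_interior, ?_,
    ⟨curv₂ θ₁ θ₂, coeff₁ θ₁ θ₂ (curv₂ θ₁ θ₂), fun x hx => ?_⟩,
    ⟨curv₁ θ₁ θ₂, coeff₂ θ₁ θ₂ (curv₁ θ₁ θ₂), fun x hx => ?_⟩⟩
  · refine Subset.antisymm (fun x hx => ?_) (union_subset
      (interior_subset.trans fun x hx => hx.1) (interior_subset.trans fun x hx => hx.1))
    have hD : ∀ᶠ y in 𝓝 x, y ∈ D := hθ.isOpen.mem_nhds hx
    -- The equation for K₁₁ read as a linear equation for K₁ - 1 along θ₂ = 0; the factor `1 *`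
    -- matches `coeff_affine`.
    have t1 : ∀ y ∈ D, coeff₁ θ₁ θ₂ (fun y => 1 * curv₁ θ₁ θ₂ y + -1) y =
        2 / 3 * (curv₂ θ₁ θ₂ y + 2) * (1 * curv₁ θ₁ θ₂ y + -1) := fun y hy => by
      rw [(coeff_affine hθ hy (s1 y hy) _ _).1, h.coeff₁₁ y hy]
      ring
    have t2 : ∀ y ∈ D, coeff₂ θ₁ θ₂ (fun y => 1 * curv₂ θ₁ θ₂ y + -1) y =
        2 / 3 * (curv₁ θ₁ θ₂ y + 2) * (1 * curv₂ θ₁ θ₂ y + -1) := fun y hy => by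
      rw [(coeff_affine hθ hy (s2 y hy) _ _).2, h.coeff₂₂ y hy]
      ring
    rcases eventually_eq_zero_of_mul_eq_zero hθ hx
      (f := fun y => 1 * curv₁ θ₁ θ₂ y + -1) (g := fun y => 1 * curv₂ θ₁ θ₂ y + -1)
      (c₁ := fun y => 2 / 3 * (curv₂ θ₁ θ₂ y + 2)) (c₂ := fun y => 2 / 3 * (curv₁ θ₁ θ₂ y + 2))
      (fun y hy => ((((hasDifferential_const 1).mul
        (hasDifferential_coeff hθ hy (s1 y hy))).add (hasDifferential_const (-1)))).1)
      (fun y hy => ((((hasDifferential_const 1).mul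
        (hasDifferential_coeff hθ hy (s2 y hy))).add (hasDifferential_const (-1)))).1)
      (continuousAt_const.mul ((s2 x hx).continuousAt.add continuousAt_const))
      (continuousAt_const.mul ((s1 x hx).continuousAt.add continuousAt_const))
      t1 t2 (fun y hy => by simpa using h0 y hy) with hz | hz
    · refine Or.inl (mem_interior_iff_mem_nhds.2 ?_)
      filter_upwards [hD, hz] with y hy hy'
      exact ⟨hy, by linarith⟩
    · refine Or.inr (mem_interior_iff_mem_nhds.2 ?_)
      filter_upwards [hD, hz] with y hy hy'
      exact ⟨hy, by linarith⟩
  · obtain ⟨hxD, hk⟩ := interior_subset hx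
    refine ⟨fun v w => by rw [extD_theta₁_eq hθ hxD, hk, one_mul], extD_theta₂_eq hθ hxD, ?_⟩
    -- At K₁ = 1 the factor ⅔(K₁ + 2) equals 2.
    have : 2 * (curv₂ θ₁ θ₂ x - 1) = coeff₂ θ₁ θ₂ (curv₂ θ₁ θ₂) x := by
      rw [h.coeff₂₂ x hxD, hk]
      ring
    rw [this]
    exact mvfderiv_eq_coeff hθ hxD _
  · obtain ⟨hxD, hk⟩ := interior_subset hx
    refine ⟨extD_theta₁_eq hθ hxD, fun v w => by rw [extD_theta₂_eq hθ hxD, hk, one_mul], ?_⟩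
    have : 2 * (curv₁ θ₁ θ₂ x - 1) = coeff₁ θ₁ θ₂ (curv₁ θ₁ θ₂) x := by
      rw [h.coeff₁₁ x hxD, hk]
      ring
    rw [this]
    exact mvfderiv_eq_coeff hθ hxD _

/-- Connectedness enters only here, to make J constant, so that it is either zero everywhere or zero
nowhere. -/
theorem HasFrobeniusInvariants.classification (hθ : IsCoframing θ₁ θ₂ D) (hc : IsConnected D)
    (h : HasFrobeniusInvariants θ₁ θ₂ D) :
    (∃ D₁ D₂ : Set M, IsOpen D₁ ∧ IsOpen D₂ ∧ D = D₁ ∪ D₂ ∧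
      TypeIOn θ₁ θ₂ D₁ ∧ TypeIDualOn θ₁ θ₂ D₂) ∨ TypeIIOn θ₁ θ₂ D := by
  have hconst : ∀ x ∈ D, ∀ y ∈ D, (curv₁ θ₁ θ₂ x + -1) * (curv₂ θ₁ θ₂ x + -1) =
      (curv₁ θ₁ θ₂ y + -1) * (curv₂ θ₁ θ₂ y + -1) := fun x hx y hy => by
    refine eq_of_mvfderiv_eq_zero (f := fun y => (curv₁ θ₁ θ₂ y + -1) * (curv₂ θ₁ θ₂ y + -1))
      hθ.isOpen hc.isPreconnected (fun z hz => ?_) (fun z hz => ?_) hx hy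
    · exact (((contMDiffAt_curv₁ hθ hz).add contMDiffAt_const).mul
        ((contMDiffAt_curv₂ hθ hz).add contMDiffAt_const)).mdifferentiableAt (n := ∞) (by simp)
    · rw [mvfderiv_eq_coeff hθ hz, h.coeff₁_mul z hz, h.coeff₂_mul z hz, zero_smul, zero_smul,
        add_zero]
  obtain ⟨x₀, hx₀⟩ := hc.nonempty
  by_cases h0 : (curv₁ θ₁ θ₂ x₀ + -1) * (curv₂ θ₁ θ₂ x₀ + -1) = 0
  · exact Or.inl (h.exists_typeI_union hθ fun x hx => (hconst x hx x₀ hx₀).trans h0)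
  · exact Or.inr (h.typeII hθ fun x hx hx0 => h0 ((hconst x₀ hx₀ x hx).trans hx0))

end Classification

end ShapeOperator

end

theorem theorem2 {M : Type*} [TopologicalSpace M] [ChartedSpace (EuclideanSpace ℝ (Fin 2)) M]
    [IsManifold (𝓡 2) ∞ M] (D : Set M) (hD : IsOpen D)
    (S : ∀ x : M, TangentSpace (𝓡 2) x →L[ℝ] TangentSpace (𝓡 2) x) (A B : M → ℝ)
    (hS : IsInvertibleNondegenerate S A B D) :
    (IsConnected D → AbpFrobeniusOn (theta₁ S A B) (theta₂ S A B) D →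
      (∃ D₁ D₂ : Set M, IsOpen D₁ ∧ IsOpen D₂ ∧ D = D₁ ∪ D₂ ∧
        TypeIOn (theta₁ S A B) (theta₂ S A B) D₁ ∧
        TypeIDualOn (theta₁ S A B) (theta₂ S A B) D₂) ∨
      TypeIIOn (theta₁ S A B) (theta₂ S A B) D) ∧
    (TypeIOn (theta₁ S A B) (theta₂ S A B) D ∨
      TypeIDualOn (theta₁ S A B) (theta₂ S A B) D ∨
      TypeIIOn (theta₁ S A B) (theta₂ S A B) D →
      AbpFrobeniusOn (theta₁ S A B) (theta₂ S A B) D) := by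
  have hθ := isCoframing_theta hD hS
  refine ⟨fun hc hF => (hasFrobeniusInvariants hθ hF).classification hθ hc, ?_⟩
  rintro (h | h | h)
  · exact abpFrobeniusOn_of_typeI hθ h
  · exact abpFrobeniusOn_of_typeIDual hθ h
  · exact abpFrobeniusOn_of_typeII hθ h
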